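/- Let $\mathbb K$ be a field of characteristic zero, let $G$ be an abelian group (written additively), and let $\varepsilon:G\times G\to\mathbb K^\times$ be an antisymmetric bicharacter, i.e. $\varepsilon(g,h)\varepsilon(h,g)=1$, $\varepsilon(g,h+k)=\varepsilon(g,h)\varepsilon(g,k)$ and $\varepsilon(g+h,k)=\varepsilon(g,k)\varepsilon(h,k)$. Let $L=\bigoplus_{g\in G}L_g$ be a $G$-graded $\varepsilon$-Lie algebra over $\mathbb K$, of arbitrary dimension: it has a bilinear bracket with $[L_g,L_h]\subseteq L_{g+h}$, $[a,b]=-\varepsilon(|a|,|b|)[b,a]$ and $$\varepsilon(|c|,|a|)[a,[b,c]]+\varepsilon(|a|,|b|)[b,[c,a]]+\varepsilon(|b|,|c|)[c,[a,b]]=0$$ for homogeneous $a,b,c$. Let $\omega:L\times L\to\mathbb K$ be a graded scalar $2$-cocycle of degree zero: a bilinear form such that, for homogeneous $x,y,z$, $\omega(x,y)=0$ if $|x|+|y|\neq 0$, $\omega(x,y)=-\varepsilon(|x|,|y|)\,\omega(y,x)$, and $$\varepsilon(|z|,|x|)\omega(x,[y,z])+\varepsilon(|x|,|y|)\omega(y,[z,x])+\varepsilon(|y|,|z|)\omega(z,[x,y])=0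 .$$ Let $T(L)$ be the tensor algebra of $L$, with its $\mathbb Z\times G$-grading in which $a_1\otimes\cdots\otimes a_n$ with $a_i\in L_{g_i}$ has degree $(n,g_1+\cdots+g_n)$. Let $U_\omega(L)$ be the quotient of $T(L)$ by the two-sided ideal generated by the elements $a\otimes b-\varepsilon(|a|,|b|)\,b\otimes a-[a,b]-\omega(a,b)$, and let $S(L)$ (the $\varepsilon$-symmetric algebra) be the quotient of $T(L)$ by the two-sided ideal generated by the elements $a\otimes b-\varepsilon(|a|,|b|)\,b\otimes a$, where $a,b$ run over the homogeneous elements of $L$. Give $S(L)$ the images of the $\mathbb Z\times G$-homogeneous components of $T(L)$, and $U_\omega(L)$ the images $U_\omega(L)_g$ of the $G$-homogeneous components of $T(L)$. For $n\in\mathbb Z$ let $U_{n,\omega}(L)$ be the image in $U_\omega(L)$ of the span of all tensors of order at most $n$ (so it is $0$ for $n<0$), let $$G_\omega(L)=\operatorname{gr}U_\omega(L)=\bigoplus_{n\in\mathbb Z}U_{n,\omega}(L)/U_{n-1,\omega}(L)$$ be the associated graded algebra, and let $G_\omega(L)_{(n,g)}$ be the image of $U_{n,\omega}(L)\cap U_\omega(L)_g$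 in $U_{n,\omega}(L)/U_{n-1,\omega}(L)$. Then $S(L)$ and $G_\omega(L)$ are $\mathbb Z\times G$-graded algebras for these components. There is exactly one algebra homomorphism $\varphi_\omega:S(L)\to G_\omega(L)$ which sends each $a\in L$ to the class in $U_{1,\omega}(L)/U_{0,\omega}(L)$ of the image of $a$ in $U_\omega(L)$, and $\varphi_\omega$ is an isomorphism of $\mathbb Z\times G$-graded algebras: it is bijective and $\varphi_\omega\bigl(S(L)_{(n,g)}\bigr)=G_\omega(L)_{(n,g)}$ for all $(n,g)\in\mathbb Z\times G$. -/

import Mathlib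

open scoped DirectSum

noncomputable section

/-! ### The associated graded algebra of a `ℤ`-filtered algebra -/

namespace FilteredAlg

variable {K A : Type*} [Field K] [Ring A] [Algebra K A]

/-- The degree `n` component `F n / F (n - 1)` of the associated graded algebra. -/
def Gr (F : ℤ → Submodule K A) (n : ℤ) : Type _ :=
  F n ⧸ (F (n - 1)).submoduleOf (F n)

instance (F : ℤ → Submodule K A) (n : ℤ) : AddCommGroup (Gr F n) :=
  inferInstanceAs (AddCommGroup (F n ⧸ (F (n - 1)).submoduleOf (F n)))

instance (F : ℤ → Submodule K A) (n : ℤ) : Module K (Gr F n) :=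
  inferInstanceAs (Module K (F n ⧸ (F (n - 1)).submoduleOf (F n)))

variable (F : ℤ → Submodule K A)

/-- The class in `F n / F (n - 1)` of an element of `F n`. -/
def symb (n : ℤ) : F n →ₗ[K] Gr F n := ((F (n - 1)).submoduleOf (F n)).mkQ

variable {F}

theorem symb_surjective (n : ℤ) : Function.Surjective (symb F n) :=
  Submodule.mkQ_surjective _

theorem symb_eq_symb_iff {n : ℤ} {x y : F n} :
    symb F n x = symb F n y ↔ (x : A) - y ∈ F (n - 1) := by
  exact Submodule.Quotient.eq ((F (n - 1)).submoduleOf (F n))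

theorem symb_mk_eq {n m : ℤ} (h : n = m) {x y : A} (hxy : x = y) (hx : x ∈ F n) (hy : y ∈ F m) :
    GradedMonoid.mk (A := Gr F) n (symb F n ⟨x, hx⟩) = GradedMonoid.mk m (symb F m ⟨y, hy⟩) := by
  subst h
  subst hxy
  rfl

variable (F)
variable [IsRingFiltration F (fun n => F (n - 1))]

theorem mul_mem {i j : ℤ} {x y : A} (hx : x ∈ F i) (hy : y ∈ F j) : x * y ∈ F (i + j) :=
  SetLike.mul_mem_graded hx hy

theorem one_mem : (1 : A) ∈ F 0 := SetLike.one_mem_graded F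

/-- The product `F i / F (i - 1) × F j / F (j - 1) → F (i + j) / F (i + j - 1)` induced by the
product of `A`. -/
def grMul (i j : ℤ) : Gr F i → Gr F j → Gr F (i + j) :=
  Quotient.map₂ (fun x y => ⟨(x : A) * y, mul_mem F x.2 y.2⟩) (by
    intro x x' hx y y' hy
    rw [← Quotient.eq_iff_equiv] at hx hy ⊢
    have hx' : (x : A) - x' ∈ F (i - 1) := symb_eq_symb_iff.1 hx
    have hy' : (y : A) - y' ∈ F (j - 1) := symb_eq_symb_iff.1 hy
    refine symb_eq_symb_iff.2 ?_
    have h1 := mul_mem F hx' y.2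
    have h2 := mul_mem F x'.2 hy'
    rw [show i - 1 + j = i + j - 1 by ring] at h1
    rw [show i + (j - 1) = i + j - 1 by ring] at h2
    have h3 := (F (i + j - 1)).add_mem h1 h2
    rw [sub_mul, mul_sub] at h3
    simpa using h3)

variable {F}

instance instGMul : GradedMonoid.GMul (Gr F) where
  mul {i j} a b := grMul F i j a b

theorem grMul_symb {i j : ℤ} (x : F i) (y : F j) :
    GradedMonoid.GMul.mul (symb F i x) (symb F j y) =
      symb F (i + j) ⟨(x : A) * y, mul_mem F x.2 y.2⟩ := rfl

instance instGOne : GradedMonoid.GOne (Gr F) where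
  one := symb F 0 ⟨1, one_mem F⟩

instance instGRing : DirectSum.GRing (Gr F) where
  mul_zero {i j} a := by
    obtain ⟨x, rfl⟩ := symb_surjective i a
    rw [← map_zero (symb F j), grMul_symb, ← map_zero (symb F (i + j))]
    congr 1
    ext
    simp
  zero_mul {i j} a := by
    obtain ⟨x, rfl⟩ := symb_surjective j a
    rw [← map_zero (symb F i), grMul_symb, ← map_zero (symb F (i + j))]
    congr 1
    ext
    simp
  mul_add {i j} a b c := by
    obtain ⟨x, rfl⟩ := symb_surjective i a
    obtain ⟨y, rfl⟩ := symb_surjective j b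
    obtain ⟨z, rfl⟩ := symb_surjective j c
    rw [← map_add (symb F j), grMul_symb, grMul_symb, grMul_symb, ← map_add (symb F (i + j))]
    congr 1
    ext
    simp [mul_add]
  add_mul {i j} a b c := by
    obtain ⟨x, rfl⟩ := symb_surjective i a
    obtain ⟨y, rfl⟩ := symb_surjective i b
    obtain ⟨z, rfl⟩ := symb_surjective j c
    rw [← map_add (symb F i), grMul_symb, grMul_symb, grMul_symb, ← map_add (symb F (i + j))]
    congr 1
    ext
    simp [add_mul]
  one_mul := by
    rintro ⟨i, a⟩
    obtain ⟨x, rfl⟩ := symb_surjective i a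
    exact symb_mk_eq (zero_add i) (one_mul (x : A)) _ x.2
  mul_one := by
    rintro ⟨i, a⟩
    obtain ⟨x, rfl⟩ := symb_surjective i a
    exact symb_mk_eq (add_zero i) (mul_one (x : A)) _ x.2
  mul_assoc := by
    rintro ⟨i, a⟩ ⟨j, b⟩ ⟨k, c⟩
    obtain ⟨x, rfl⟩ := symb_surjective i a
    obtain ⟨y, rfl⟩ := symb_surjective j b
    obtain ⟨z, rfl⟩ := symb_surjective k c
    exact symb_mk_eq (add_assoc i j k) (mul_assoc (x : A) y z) _ _
  natCast n := n • symb F 0 ⟨1, one_mem F⟩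
  natCast_zero := zero_smul _ _
  natCast_succ n := succ_nsmul _ n
  intCast n := n • symb F 0 ⟨1, one_mem F⟩
  intCast_ofNat n := natCast_zsmul _ n
  intCast_negSucc_ofNat n := negSucc_zsmul _ n

instance instGAlgebra : DirectSum.GAlgebra K (Gr F) where
  toFun := ((LinearMap.toSpanSingleton K (Gr F 0) (symb F 0 ⟨1, one_mem F⟩)).toAddMonoidHom)
  map_one := one_smul K (symb F 0 ⟨1, one_mem F⟩)
  map_mul r s := by
    refine symb_mk_eq (zero_add 0).symm (x := (r * s) • (1 : A)) (y := (r • 1) * (s • 1)) ?_ _ _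
    rw [smul_mul_smul_comm, one_mul]
  commutes := by
    rintro r ⟨i, a⟩
    obtain ⟨x, rfl⟩ := symb_surjective i a
    refine symb_mk_eq ((zero_add i).trans (add_zero i).symm)
      (x := (r • (1 : A)) * x) (y := x * (r • (1 : A))) ?_ _ _
    rw [smul_mul_assoc, mul_smul_comm, one_mul, mul_one]
  smul_def := by
    rintro r ⟨i, a⟩
    obtain ⟨x, rfl⟩ := symb_surjective i a
    refine symb_mk_eq (zero_add i).symm (x := r • (x : A)) (y := (r • (1 : A)) * x) ?_ _ _
    rw [smul_mul_assoc, one_mul]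

end FilteredAlg

/-! ### Color Lie algebras, scalar cocycles and generalized enveloping algebras -/

namespace ColorLie

set_option linter.unusedSectionVars false

variable {K G L : Type*} [Field K] [AddCommGroup G] [AddCommGroup L] [Module K L]

/-- `ε` is an antisymmetric bicharacter of the abelian group `G` (written additively). -/
structure IsAntisymmBicharacter (ε : G → G → Kˣ) : Prop where
  mul_swap : ∀ g h, ε g h * ε h g = 1
  add_right : ∀ g h k, ε g (h + k) = ε g h * ε g k
  add_left : ∀ g h k, ε (g + h) k = ε g k * ε h k

/-- `L`, with the homogeneous components `𝓛 g` and the bracket `br`, is a `G`-graded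
`ε`-Lie algebra (color Lie algebra). -/
structure IsColorLieAlgebra [DecidableEq G] (ε : G → G → Kˣ) (𝓛 : G → Submodule K L)
    (br : L →ₗ[K] L →ₗ[K] L) : Prop where
  isInternal : DirectSum.IsInternal 𝓛
  bracket_mem : ∀ {g h : G} {a b : L}, a ∈ 𝓛 g → b ∈ 𝓛 h → br a b ∈ 𝓛 (g + h)
  skew : ∀ {g h : G} {a b : L}, a ∈ 𝓛 g → b ∈ 𝓛 h → br a b = -((ε g h : K) • br b a)
  jacobi : ∀ {g h k : G} {a b c : L}, a ∈ 𝓛 g → b ∈ 𝓛 h → c ∈ 𝓛 k →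
    (ε k g : K) • br a (br b c) + (ε g h : K) • br b (br c a) + (ε h k : K) • br c (br a b) = 0

/-- `ω` is a graded scalar 2-cocycle: an `ε`-skew-symmetric bilinear form of degree zero
(`K` being concentrated in degree zero) which satisfies the cocycle identity for the trivial
module `K`. -/
structure IsScalarTwoCocycle (ε : G → G → Kˣ) (𝓛 : G → Submodule K L)
    (br : L →ₗ[K] L →ₗ[K] L) (ω : L →ₗ[K] L →ₗ[K] K) : Prop where
  degree_zero : ∀ {g h : G} {x y : L}, x ∈ 𝓛 g → y ∈ 𝓛 h → g + h ≠ 0 → ω x y = 0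
  skew : ∀ {g h : G} {x y : L}, x ∈ 𝓛 g → y ∈ 𝓛 h → ω x y = -((ε g h : K) * ω y x)
  cocycle : ∀ {g h k : G} {x y z : L}, x ∈ 𝓛 g → y ∈ 𝓛 h → z ∈ 𝓛 k →
    (ε k g : K) * ω x (br y z) + (ε g h : K) * ω y (br z x) + (ε h k : K) * ω z (br x y) = 0

/-- The generators of the ideal which defines the generalized enveloping algebra:
`a ⊗ b - ε(|a|, |b|) b ⊗ a - [a, b] - ω(a, b)`, for homogeneous `a`, `b`, are set to zero. -/
inductive EnvRel (ε : G → G → Kˣ) (𝓛 : G → Submodule K L) (br : L →ₗ[K] L →ₗ[K] L)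
    (ω : L →ₗ[K] L →ₗ[K] K) : TensorAlgebra K L → TensorAlgebra K L → Prop
  | rel {g h : G} {a b : L} (ha : a ∈ 𝓛 g) (hb : b ∈ 𝓛 h) :
      EnvRel ε 𝓛 br ω
        (TensorAlgebra.ι K a * TensorAlgebra.ι K b
          - (ε g h : K) • (TensorAlgebra.ι K b * TensorAlgebra.ι K a)
          - TensorAlgebra.ι K (br a b) - algebraMap K (TensorAlgebra K L) (ω a b)) 0

/-- The generalized enveloping algebra `U_ω(L)`: the quotient of the tensor algebra `T(L)` by the
two-sided ideal generated by the elements above. -/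
def GenEnv (ε : G → G → Kˣ) (𝓛 : G → Submodule K L) (br : L →ₗ[K] L →ₗ[K] L)
    (ω : L →ₗ[K] L →ₗ[K] K) : Type _ :=
  RingQuot (EnvRel ε 𝓛 br ω)

instance (ε : G → G → Kˣ) (𝓛 : G → Submodule K L) (br : L →ₗ[K] L →ₗ[K] L)
    (ω : L →ₗ[K] L →ₗ[K] K) : Ring (GenEnv ε 𝓛 br ω) :=
  inferInstanceAs (Ring (RingQuot (EnvRel ε 𝓛 br ω)))

instance (ε : G → G → Kˣ) (𝓛 : G → Submodule K L) (br : L →ₗ[K] L →ₗ[K] L)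
    (ω : L →ₗ[K] L →ₗ[K] K) : Algebra K (GenEnv ε 𝓛 br ω) :=
  inferInstanceAs (Algebra K (RingQuot (EnvRel ε 𝓛 br ω)))

/-- The `ε`-symmetric algebra `S(L)` of a graded space: the quotient of `T(L)` by the two-sided
ideal generated by the elements `a ⊗ b - ε(|a|, |b|) b ⊗ a`, i.e. the case of zero bracket and
zero cocycle. -/
abbrev SymAlg (ε : G → G → Kˣ) (𝓛 : G → Submodule K L) : Type _ :=
  GenEnv ε 𝓛 0 0

/-- The component of degree `(n, g)` of the `ℤ × G`-graded algebra `T(L)`: the span of the tensors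
`a₁ ⊗ ⋯ ⊗ aₙ` with `aᵢ` homogeneous of degree `dᵢ` and `d₁ + ⋯ + dₙ = g`
(it is zero for negative `n`). -/
def tensorGrading (𝓛 : G → Submodule K L) (p : ℤ × G) : Submodule K (TensorAlgebra K L) :=
  Submodule.span K {t | ∃ (n : ℕ) (a : Fin n → L) (d : Fin n → G),
    (∀ i, a i ∈ 𝓛 (d i)) ∧ ((n : ℤ), ∑ i, d i) = p ∧ t = TensorAlgebra.tprod K L n a}

/-- The subspace `T_n(L)` of `T(L)` spanned by the tensors of order at most `n`
(it is zero for negative `n`). -/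
def tensorFiltration (K L : Type*) [Field K] [AddCommGroup L] [Module K L] (n : ℤ) :
    Submodule K (TensorAlgebra K L) :=
  ⨆ (m : ℕ) (_ : (m : ℤ) ≤ n), LinearMap.range (TensorAlgebra.ι K (M := L)) ^ m

theorem pow_le_tensorFiltration {m : ℕ} {n : ℤ} (h : (m : ℤ) ≤ n) :
    LinearMap.range (TensorAlgebra.ι K (M := L)) ^ m ≤ tensorFiltration K L n :=
  le_iSup₂_of_le m h le_rfl

theorem tensorFiltration_mul_le (i j : ℤ) :
    tensorFiltration K L i * tensorFiltration K L j ≤ tensorFiltration K L (i + j) := by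
  unfold tensorFiltration
  simp only [Submodule.iSup_mul, Submodule.mul_iSup]
  refine iSup₂_le fun m hm => iSup₂_le fun k hk => ?_
  rw [← pow_add]
  exact pow_le_tensorFiltration (by push_cast; omega)

section

variable (ε : G → G → Kˣ) (𝓛 : G → Submodule K L) (br : L →ₗ[K] L →ₗ[K] L)
  (ω : L →ₗ[K] L →ₗ[K] K)

/-- The quotient map `T(L) → U_ω(L)`. -/
def envMk : TensorAlgebra K L →ₐ[K] GenEnv ε 𝓛 br ω := RingQuot.mkAlgHom K (EnvRel ε 𝓛 br ω)

/-- The canonical map `i_ω : L → U_ω(L)`. -/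
def envι : L →ₗ[K] GenEnv ε 𝓛 br ω := (envMk ε 𝓛 br ω).toLinearMap ∘ₗ TensorAlgebra.ι K

theorem envι_rel {g h : G} {a b : L} (ha : a ∈ 𝓛 g) (hb : b ∈ 𝓛 h) :
    envι ε 𝓛 br ω a * envι ε 𝓛 br ω b - (ε g h : K) • (envι ε 𝓛 br ω b * envι ε 𝓛 br ω a) =
      envι ε 𝓛 br ω (br a b) + algebraMap K _ (ω a b) := by
  have h0 : envMk ε 𝓛 br ω _ = envMk ε 𝓛 br ω _ :=
    RingQuot.mkAlgHom_rel K (EnvRel.rel (ε := ε) (br := br) (ω := ω) ha hb)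
  simp only [map_sub, map_mul, map_smul, AlgHom.commutes, map_zero] at h0
  rw [sub_sub, sub_eq_zero] at h0
  exact h0

/-- The filtration of `U_ω(L)`: `U_{n,ω}(L)` is the canonical image of `T_n(L)`, that is, the span
of the products of at most `n` elements of `L`; it is zero for negative `n`. -/
def envFiltration (n : ℤ) : Submodule K (GenEnv ε 𝓛 br ω) :=
  (tensorFiltration K L n).map (envMk ε 𝓛 br ω).toLinearMap

/-- The `G`-grading of `U_ω(L)`: the canonical image of the `G`-grading of `T(L)`. -/
def envGrading (g : G) : Submodule K (GenEnv ε 𝓛 br ω) :=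
  (⨆ n : ℤ, tensorGrading 𝓛 (n, g)).map (envMk ε 𝓛 br ω).toLinearMap

instance envFiltration_isRingFiltration :
    IsRingFiltration (envFiltration ε 𝓛 br ω) (fun n => envFiltration ε 𝓛 br ω (n - 1)) := by
  have : SetLike.GradedMonoid (envFiltration ε 𝓛 br ω) :=
    { one_mem := by
        refine ⟨1, ?_, map_one (envMk ε 𝓛 br ω)⟩
        refine pow_le_tensorFiltration (m := 0) le_rfl ?_
        rw [pow_zero]
        exact Submodule.one_le.1 le_rfl
      mul_mem := by
        rintro i j _ _ ⟨x, hx, rfl⟩ ⟨y, hy, rfl⟩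
        exact ⟨x * y, tensorFiltration_mul_le i j (Submodule.mul_mem_mul hx hy),
          map_mul (envMk ε 𝓛 br ω) x y⟩ }
  refine IsRingFiltration.mk_int _ fun i j hij => Submodule.map_mono ?_
  exact iSup₂_le fun m hm => pow_le_tensorFiltration (hm.trans hij)

/-- `G_ω(L)`, the algebra `⨁ₙ U_{n,ω}(L) / U_{n-1,ω}(L)` associated with the filtered algebra
`U_ω(L)`. -/
abbrev GrEnv : Type _ := ⨁ n : ℤ, FilteredAlg.Gr (envFiltration ε 𝓛 br ω) n

/-- The component of degree `(n, g)` of `G_ω(L)`: the classes in `U_{n,ω}(L) / U_{n-1,ω}(L)` of the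
elements of `U_{n,ω}(L)` which are homogeneous of degree `g`. -/
def grGrading (p : ℤ × G) : Submodule K (GrEnv ε 𝓛 br ω) :=
  (((envGrading ε 𝓛 br ω p.2).submoduleOf (envFiltration ε 𝓛 br ω p.1)).map
    (FilteredAlg.symb (envFiltration ε 𝓛 br ω) p.1)).map
      (DirectSum.lof K ℤ (FilteredAlg.Gr (envFiltration ε 𝓛 br ω)) p.1)

/-- The `ℤ × G`-grading of `S(L)`, the canonical image of that of `T(L)`. -/
def symGrading (p : ℤ × G) : Submodule K (SymAlg ε 𝓛) :=
  (tensorGrading 𝓛 p).map (envMk ε 𝓛 0 0).toLinearMap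

theorem envι_mem (a : L) : envι ε 𝓛 br ω a ∈ envFiltration ε 𝓛 br ω 1 :=
  ⟨TensorAlgebra.ι K a, pow_le_tensorFiltration (m := 1) le_rfl
    (by rw [pow_one]; exact LinearMap.mem_range_self _ a), rfl⟩

/-- The canonical map `L → U_ω(L) → G_ω(L)`, which sends `a` to the class of `i_ω(a)` in
`U_{1,ω}(L) / U_{0,ω}(L)`. -/
def grι : L →ₗ[K] GrEnv ε 𝓛 br ω :=
  DirectSum.lof K ℤ (FilteredAlg.Gr (envFiltration ε 𝓛 br ω)) 1 ∘ₗ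
    FilteredAlg.symb (envFiltration ε 𝓛 br ω) 1 ∘ₗ
      (envι ε 𝓛 br ω).codRestrict (envFiltration ε 𝓛 br ω 1) (envι_mem ε 𝓛 br ω)

theorem grι_mul_grι (a b : L) :
    grι ε 𝓛 br ω a * grι ε 𝓛 br ω b =
      DirectSum.lof K ℤ (FilteredAlg.Gr (envFiltration ε 𝓛 br ω)) (1 + 1)
        (FilteredAlg.symb (envFiltration ε 𝓛 br ω) (1 + 1)
          ⟨envι ε 𝓛 br ω a * envι ε 𝓛 br ω b, FilteredAlg.mul_mem (envFiltration ε 𝓛 br ω)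
            (envι_mem ε 𝓛 br ω a) (envι_mem ε 𝓛 br ω b)⟩) :=
  DirectSum.of_mul_of _ _

/-- The images of homogeneous elements of `L` in `G_ω(L)` `ε`-commute. -/
theorem grι_comm {g h : G} {a b : L} (ha : a ∈ 𝓛 g) (hb : b ∈ 𝓛 h) :
    grι ε 𝓛 br ω a * grι ε 𝓛 br ω b - (ε g h : K) • (grι ε 𝓛 br ω b * grι ε 𝓛 br ω a) = 0 := by
  rw [grι_mul_grι, grι_mul_grι, ← map_smul, ← map_smul, sub_eq_zero]
  congr 1
  rw [FilteredAlg.symb_eq_symb_iff]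
  change envι ε 𝓛 br ω a * envι ε 𝓛 br ω b
    - (ε g h : K) • (envι ε 𝓛 br ω b * envι ε 𝓛 br ω a) ∈ envFiltration ε 𝓛 br ω (1 + 1 - 1)
  rw [envι_rel ε 𝓛 br ω ha hb, show (1 + 1 - 1 : ℤ) = 1 by norm_num, Algebra.algebraMap_eq_smul_one]
  refine Submodule.add_mem _ (envι_mem ε 𝓛 br ω _) (Submodule.smul_mem _ _ ?_)
  exact IsFiltration.mono (F := envFiltration ε 𝓛 br ω) zero_le_one
    (FilteredAlg.one_mem (envFiltration ε 𝓛 br ω))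

/-- The canonical homomorphism `φ_ω : S(L) → G_ω(L)`, the algebra homomorphism which extends
`L → G_ω(L)`. -/
def canonicalHom : SymAlg ε 𝓛 →ₐ[K] GrEnv ε 𝓛 br ω :=
  RingQuot.liftAlgHom K ⟨TensorAlgebra.lift K (grι ε 𝓛 br ω), by
    rintro _ _ ⟨ha, hb⟩
    simpa using grι_comm ε 𝓛 br ω ha hb⟩

/-- `φ_ω` extends the map `L → G_ω(L)`. -/
theorem canonicalHom_ι (a : L) :
    canonicalHom ε 𝓛 br ω (envι ε 𝓛 0 0 a) = grι ε 𝓛 br ω a := by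
  have h := RingQuot.liftAlgHom_mkAlgHom_apply K (TensorAlgebra.lift K (grι ε 𝓛 br ω))
    (s := EnvRel ε 𝓛 0 0) (by
      rintro _ _ ⟨ha, hb⟩
      simpa using grι_comm ε 𝓛 br ω ha hb) (TensorAlgebra.ι K a)
  rw [TensorAlgebra.lift_ι_apply] at h
  exact h

end

end ColorLie

end

/-! Surjectivity of `φ_ω` is formal: an element of `U_{n,ω}(L)` is, up to lower order, the image of
a tensor of order exactly n. Injectivity is the Poincaré–Birkhoff–Witt statement: a tensor of order
n whose image in `U_ω(L)` has order below n vanishes in `S(L)`. No basis of either algebra is needed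
for it. It suffices to have a linear map Φ from `T(L)` to `S(L)` which kills the ideal defining
`U_ω(L)` and agrees with the canonical projection up to lower order. If t of order n and t' of order
below n have the same image in `U_ω(L)`, then Φ t = Φ t' has lower order, hence so does the image of
t in `S(L)`; as `S(L)` is graded by order, this image is zero.

Φ is `straightenMap`. It rewrites words in a linearly ordered homogeneous basis: an inversion xy
becomes ε(x,y) yx + [x,y] + ω(x,y), an odd square xx becomes half of [x,x] + ω(x,x), and irreducible
words go to their images in `S(L)`. By construction Φ kills the relator at one chosen position of
each reducible word; that it kills all relators is a confluence statement, `defect_eq_zero`. Its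
hypotheses come from three identities in `T(L)`: `relator_skew`, `relator_comm` and `relator_braid`.
The error terms of the last two involve only shorter words, so an induction on length applies. The
Jacobi identity, the cocycle identity and the degree of ω enter through the braid identity.
Characteristic zero matters only in that 2 and 3 are invertible.

Gradings come from coactions (`exists_projections`), since the relations are homogeneous. The
grading of `G_ω(L)` is transported from `S(L)` along `φ_ω`. -/

open scoped DirectSum

/-! ### A confluence lemma for rewriting words over a linearly ordered alphabet -/

namespace ColorLie

section Confluence

variable {X K V : Type*} [LinearOrder X]

/-- The number of inversions of a word. -/
def inversions : List X → ℕ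
  | [] => 0
  | x :: w => w.countP (· < x) + inversions w

/-- A letter of `u` only sees the multiset of letters after it, which the swap preserves; exactly
the one inversion between `x` and `y` is lost. -/
theorem inversions_swap_lt (u v : List X) {x y : X} (h : y < x) :
    inversions (u ++ y :: x :: v) < inversions (u ++ x :: y :: v) := by
  induction u with
  | nil =>
    simp only [List.nil_append, inversions, List.countP_cons, decide_eq_true_eq, h, if_true,
      not_lt.2 h.le, if_false]
    omega
  | cons z u ih =>
    simp only [List.cons_append, inversions]
    have hp : (u ++ y :: x :: v).countP (· < z) = (u ++ x :: y :: v).countP (· < z) :=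
      ((List.Perm.swap x y v).append_left u).countP_eq _
    omega

variable [Field K] [AddCommGroup V] [Module K V]

/-- Two adjacent letters which can be rewritten: an inversion, or a repeated odd letter. -/
def Redex (e : X → X → K) (x y : X) : Prop := y < x ∨ y = x ∧ e x x = -1

/-- If `p u x y v` is the defect of the rewriting rule for `x y` at a position of a word of
length `n`, and if the defects satisfy the relations which come from the commutation and braid
relations of adjacent transpositions, then it is enough that in each reducible word the rule
holds at one position. -/
theorem defect_eq_zero [CharZero K] (e : X → X → K) (he : ∀ x y, e x y * e y x = 1) (n : ℕ)
    (p : List X → X → X → List X → V)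
    (skew : ∀ u x y v, u.length + v.length + 2 = n → p u x y v + e x y • p u y x v = 0)
    (comm : ∀ u x y m z t v, u.length + m.length + v.length + 4 = n →
      p u x y (m ++ z :: t :: v) + e x y • p (u ++ y :: x :: m) z t v =
        p (u ++ x :: y :: m) z t v + e z t • p u x y (m ++ t :: z :: v))
    (braid : ∀ u x y z v, u.length + v.length + 3 = n →
      p u x y (z :: v) + e x y • p (u ++ [y]) x z v + (e x y * e x z) • p u y z (x :: v) =
        p (u ++ [x]) y z v + e y z • p u x z (y :: v) + (e y z * e x z) • p (u ++ [z]) x y v)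
    (red : ∀ u x y v, u.length + v.length + 2 = n → Redex e x y → ∃ u' x' y' v',
      u ++ x :: y :: v = u' ++ x' :: y' :: v' ∧ Redex e x' y' ∧ p u' x' y' v' = 0)
    (u : List X) (x y : X) (v : List X) (hn : u.length + v.length + 2 = n) :
    p u x y v = 0 := by
  -- An odd repeated letter is fixed by its own swap, which leads to coefficients 2; three equal odd
  -- letters lead to 3.
  have two : (2 : K) ≠ 0 := two_ne_zero
  have three : (3 : K) ≠ 0 := three_ne_zero
  -- Induction on inversions: within one word, vanishing of the defect at one redex is equivalent to
  -- vanishing at any other, and `red` supplies one where it vanishes.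
  have main : ∀ N : ℕ, ∀ u x y v, u.length + v.length + 2 = n → Redex e x y →
      inversions (u ++ x :: y :: v) = N → p u x y v = 0 := by
    intro N
    induction N using Nat.strong_induction_on with
    | _ N ih =>
    have ih' : ∀ w : List X, inversions w < N → ∀ u x y v, w = u ++ x :: y :: v →
        u.length + v.length + 2 = n → Redex e x y → p u x y v = 0 := by
      intro w hw u x y v h1 h2 h3
      exact ih _ (h1 ▸ hw) u x y v h2 h3 rfl
    -- two redexes at distance at least two
    have far : ∀ u x y m z t v, u.length + m.length + v.length + 4 = n → Redex e x y →
        Redex e z t → inversions (u ++ x :: y :: (m ++ z :: t :: v)) = N →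
        (p u x y (m ++ z :: t :: v) = 0 ↔ p (u ++ x :: y :: m) z t v = 0) := by
      intro u x y m z t v hl hxy hzt hN
      have c := comm u x y m z t v hl
      -- Swapping an inversion elsewhere leaves the redex `z t` in a word with fewer inversions.
      -- Swapping an odd repeated letter returns the same word with sign -1, so that term is moved
      -- to the other side instead.
      have c1 : x = y ∧ e x y = -1 ∨ p (u ++ y :: x :: m) z t v = 0 := by
        rcases hxy with h | ⟨rfl, h⟩
        · right
          refine ih' (u ++ y :: x :: (m ++ z :: t :: v)) (hN ▸ inversions_swap_lt _ _ h)
            _ _ _ _ (by simp) (by simp; omega) hzt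
        · exact Or.inl ⟨rfl, h⟩
      have c2 : z = t ∧ e z t = -1 ∨ p u x y (m ++ t :: z :: v) = 0 := by
        rcases hzt with h | ⟨rfl, h⟩
        · right
          refine ih' ((u ++ x :: y :: m) ++ t :: z :: v) ?_
            _ _ _ _ (by simp) (by simp; omega) hxy
          rw [← hN, show u ++ x :: y :: (m ++ z :: t :: v) = (u ++ x :: y :: m) ++ z :: t :: v
            by simp]
          exact inversions_swap_lt _ _ h
        · exact Or.inl ⟨rfl, h⟩
      rcases c1 with ⟨rfl, h1⟩ | h1 <;> rcases c2 with ⟨rfl, h2⟩ | h2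
      · rw [h1, h2] at c
        have c' : (2 : K) • p u x x (m ++ z :: z :: v) = (2 : K) • p (u ++ x :: x :: m) z z v := by
          linear_combination (norm := module) c
        rw [smul_right_injective V two c']
      · rw [h1, h2] at c
        have c' : p u x x (m ++ z :: t :: v) = (2 : K) • p (u ++ x :: x :: m) z t v := by
          linear_combination (norm := module) c
        rw [c', smul_eq_zero_iff_right two]
      · rw [h1, h2] at c
        have c' : (2 : K) • p u x y (m ++ z :: z :: v) = p (u ++ x :: y :: m) z z v := by
          linear_combination (norm := module) c
        rw [← c', smul_eq_zero_iff_right two]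
      · rw [h1, h2, smul_zero, smul_zero, add_zero, add_zero] at c
        rw [c]
    -- two overlapping redexes
    have near : ∀ u x y z v, u.length + v.length + 3 = n → Redex e x y →
        Redex e y z → inversions (u ++ x :: y :: z :: v) = N →
        (p u x y (z :: v) = 0 ↔ p (u ++ [x]) y z v = 0) := by
      intro u x y z v hl hxy hyz hN
      have b := braid u x y z v hl
      have e1 : ∀ {x y}, y < x → Redex e x y := fun h => Or.inl h
      -- The terms of the braid relation other than the two compared belong to partially sorted
      -- words, where the induction hypothesis applies.
      have A1 : y < x → Redex e x z → p (u ++ [y]) x z v = 0 := fun h h' =>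
        ih' (u ++ y :: x :: z :: v) (hN ▸ inversions_swap_lt _ _ h) _ _ _ _ (by simp)
          (by simp; omega) h'
      have A2 : z < y → Redex e x z → p u x z (y :: v) = 0 := fun h h' => by
        refine ih' ((u ++ [x]) ++ z :: y :: v) ?_ _ _ _ _ (by simp)
          (by simp; omega) h'
        rw [← hN, show u ++ x :: y :: z :: v = (u ++ [x]) ++ y :: z :: v by simp]
        exact inversions_swap_lt _ _ h
      have A3 : y < x → z < x → p u y z (x :: v) = 0 := fun h h' => by
        refine ih' (u ++ y :: z :: x :: v) (lt_trans ?_ (hN ▸ inversions_swap_lt _ _ h)) _ _ _ _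
          (by simp) (by simp; omega) hyz
        simpa using inversions_swap_lt (u ++ [y]) v h'
      have A4 : z < y → z < x → p (u ++ [z]) x y v = 0 := fun h h' => by
        refine ih' (u ++ z :: x :: y :: v) (lt_trans (inversions_swap_lt _ _ h') ?_) _ _ _ _
          (by simp) (by simp; omega) hxy
        rw [← hN, show u ++ x :: y :: z :: v = (u ++ [x]) ++ y :: z :: v by simp]
        simpa using inversions_swap_lt (u ++ [x]) v h
      rcases id hxy with h1 | ⟨rfl, h1⟩ <;> rcases id hyz with h2 | ⟨rfl, h2⟩
      · rw [A1 h1 (e1 (h2.trans h1)), A2 h2 (e1 (h2.trans h1)), A3 h1 (h2.trans h1),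
          A4 h2 (h2.trans h1)] at b
        simp only [smul_zero, add_zero] at b
        rw [b]
      · rw [A1 h1 hxy, A3 h1 h1, h2] at b
        have c' : (2 : K) • p u x z (z :: v) = p (u ++ [x]) z z v := by
          linear_combination (norm := module) b
        rw [← c', smul_eq_zero_iff_right two]
      · rw [A2 h2 hyz, A4 h2 h2, h1] at b
        have c' : p u y y (z :: v) = (2 : K) • p (u ++ [y]) y z v := by
          linear_combination (norm := module) b
        rw [c', smul_eq_zero_iff_right two]
      · rw [h1] at b
        -- Three equal odd letters: all six terms of the braid relation live on the same word, with
        -- coefficients 1, -1, 1 on each side.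
        have c' : (3 : K) • p u z z (z :: v) = (3 : K) • p (u ++ [z]) z z v := by
          linear_combination (norm := module) b
        rw [smul_right_injective V three c']
    intro u x y v hl hr hN
    obtain ⟨u', x', y', v', hw, hr', hp⟩ := red u x y v hl hr
    have hl' : u'.length + v'.length + 2 = n := by
      have := congrArg List.length hw
      simp at this
      omega
    -- The length of `m` is the distance between the two redexes: they coincide, overlap in one
    -- letter, or are disjoint.
    rcases List.append_eq_append_iff.1 hw with ⟨m, h1, h2⟩ | ⟨m, h1, h2⟩
    · rcases m with _ | ⟨a, _ | ⟨b, m⟩⟩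
      · simp at h1 h2
        obtain ⟨rfl, rfl, rfl⟩ := h2
        subst h1
        exact hp
      · simp at h1 h2
        obtain ⟨rfl, rfl, rfl⟩ := h2
        subst h1
        exact (near u x _ _ _ (by simp at hl; omega) hr hr' hN).2 hp
      · simp at h1 h2
        obtain ⟨rfl, rfl, rfl⟩ := h2
        subst h1
        exact (far u _ _ m _ _ _ (by simp at hl; omega) hr hr' hN).2 hp
    · rcases m with _ | ⟨a, _ | ⟨b, m⟩⟩
      · simp at h1 h2
        obtain ⟨rfl, rfl, rfl⟩ := h2
        subst h1
        exact hp
      · simp at h1 h2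
        obtain ⟨rfl, rfl, rfl⟩ := h2
        subst h1
        exact (near u' _ _ _ _ (by simp at hl; omega) hr' hr (by rw [← hN]; simp)).1 hp
      · simp at h1 h2
        obtain ⟨rfl, rfl, rfl⟩ := h2
        subst h1
        exact (far u' _ _ m _ _ _ (by simp at hl; omega) hr' hr (by rw [← hN]; simp)).1 hp
  by_cases hr : Redex e x y
  -- Pairs that are not redexes reduce by `skew` either to the reversed inversion or, for an even
  -- repeated letter, to twice the defect being zero.
  · exact main _ u x y v hn hr rfl
  by_cases hr' : Redex e y x
  · have h := skew u x y v hn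
    rwa [main _ u y x v hn hr' rfl, smul_zero, add_zero] at h
  have hxy : x = y := by
    unfold Redex at hr hr'
    push Not at hr hr'
    exact le_antisymm hr.1 hr'.1
  subst hxy
  have h1 : e x x = 1 := by
    rcases mul_self_eq_one_iff.1 (he x x) with h | h
    · exact h
    · exact absurd (Or.inr ⟨rfl, h⟩) hr
  have h := skew u x x v hn
  rw [h1, one_smul, ← two_smul K, smul_eq_zero_iff_right two] at h
  exact h

end Confluence

end ColorLie

noncomputable section

/-! ### Straightening of words -/

namespace ColorLie

section Words

variable {X K L V : Type*} [Field K] [AddCommGroup L] [Module K L] [AddCommGroup V] [Module K V]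
variable (b : Module.Basis X K L)

/-- The product in `T(L)` of the basis elements named by a word. -/
def word (w : List X) : TensorAlgebra K L := (w.map fun x => TensorAlgebra.ι K (b x)).prod

@[simp] theorem word_nil : word b [] = 1 := rfl

@[simp] theorem word_cons (x : X) (w : List X) :
    word b (x :: w) = TensorAlgebra.ι K (b x) * word b w := List.prod_cons

@[simp] theorem word_append (u v : List X) : word b (u ++ v) = word b u * word b v := by
  simp [word]

theorem tensorAlgebra_basis_apply (w : FreeMonoid X) :
    b.tensorAlgebra w = word b w.toList := by
  induction w using FreeMonoid.recOn with
  | one => simp [Module.Basis.tensorAlgebra, FreeAlgebra.basisFreeMonoid,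
      FreeAlgebra.equivMonoidAlgebraFreeMonoid]
  | of_mul x w ih =>
    rw [FreeMonoid.toList_of_mul, word_cons, ← ih]
    simp [Module.Basis.tensorAlgebra, FreeAlgebra.basisFreeMonoid,
      FreeAlgebra.equivMonoidAlgebraFreeMonoid]

/-- The linear map on `T(L)` with prescribed values on words. -/
def extendWords (F : List X → V) : TensorAlgebra K L →ₗ[K] V :=
  b.tensorAlgebra.constr K fun w => F w.toList

@[simp] theorem extendWords_word (F : List X → V) (w : List X) :
    extendWords b F (word b w) = F w := by
  have h := b.tensorAlgebra.constr_basis K (fun w => F w.toList) (FreeMonoid.ofList w)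
  rwa [tensorAlgebra_basis_apply] at h

/-- With `a` a bracket of basis elements, this identifies the sum in the rewriting rule with the
value of the linear extension. -/
theorem extendWords_word_ι_word (F : List X → V) (u v : List X) (a : L) :
    extendWords b F (word b u * TensorAlgebra.ι K a * word b v) =
      (b.repr a).sum fun z c => c • F (u ++ z :: v) := by
  conv_lhs => rw [← b.linearCombination_repr a]
  rw [Finsupp.linearCombination_apply, Finsupp.sum, Finsupp.sum]
  simp only [map_sum, Finset.mul_sum, Finset.sum_mul, map_smul, mul_smul_comm, smul_mul_assoc]
  refine Finset.sum_congr rfl fun z _ => ?_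
  rw [← extendWords_word b F, word_append, word_cons, mul_assoc]

variable (br : L →ₗ[K] L →ₗ[K] L) (ω : L →ₗ[K] L →ₗ[K] K)

/-- The relator `a ⊗ b - k b ⊗ a - [a, b] - ω(a, b)`. -/
def relator (a c : L) (k : K) : TensorAlgebra K L :=
  TensorAlgebra.ι K a * TensorAlgebra.ι K c - k • (TensorAlgebra.ι K c * TensorAlgebra.ι K a)
    - TensorAlgebra.ι K (br a c) - algebraMap K (TensorAlgebra K L) (ω a c)

theorem extendWords_relator (F : List X → V) (u v : List X) (x y : X) (k : K) :
    extendWords b F (word b u * relator br ω (b x) (b y) k * word b v) =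
      F (u ++ x :: y :: v) - k • F (u ++ y :: x :: v) -
        ((b.repr (br (b x) (b y))).sum fun z c => c • F (u ++ z :: v)) -
        ω (b x) (b y) • F (u ++ v) := by
  rw [← extendWords_word_ι_word]
  simp only [← extendWords_word b F]
  simp only [← map_smul, ← map_sub, word_append, word_cons]
  congr 1
  simp only [relator, mul_sub, sub_mul, Algebra.algebraMap_eq_smul_one, mul_smul_comm,
    smul_mul_assoc, mul_one, mul_assoc]

variable [LinearOrder X] (e : X → X → K) (nf : List X → V)

open Classical in
/-- The value of a word, computed by rewriting it with the relations of the generalized enveloping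
algebra; irreducible words have the prescribed values `nf`. -/
def straighten (w : List X) : V :=
  if h : ∃ r : List X × X × X × List X,
      w = r.1 ++ r.2.1 :: r.2.2.1 :: r.2.2.2 ∧ Redex e r.2.1 r.2.2.1 then
    if h.choose.2.2.1 < h.choose.2.1 then
      ((b.repr (br (b h.choose.2.1) (b h.choose.2.2.1))).sum fun z c =>
        c • straighten (h.choose.1 ++ z :: h.choose.2.2.2)) +
      ω (b h.choose.2.1) (b h.choose.2.2.1) • straighten (h.choose.1 ++ h.choose.2.2.2) +
      e h.choose.2.1 h.choose.2.2.1 •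
        straighten (h.choose.1 ++ h.choose.2.2.1 :: h.choose.2.1 :: h.choose.2.2.2)
    else
      -- Here the two letters are equal and odd, so the relator reads 2xx - [x,x] - ω(x,x).
      (2 : K)⁻¹ • (((b.repr (br (b h.choose.2.1) (b h.choose.2.2.1))).sum fun z c =>
        c • straighten (h.choose.1 ++ z :: h.choose.2.2.2)) +
      ω (b h.choose.2.1) (b h.choose.2.2.1) • straighten (h.choose.1 ++ h.choose.2.2.2))
  else nf w
-- The bracket and cocycle terms shorten the word; the swapped word keeps its length and loses an
-- inversion.
termination_by (w.length, inversions w)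
decreasing_by
  all_goals
    have hw := congrArg List.length h.choose_spec.1
    simp only [List.length_append, List.length_cons] at hw
  · exact Prod.Lex.left _ _ (by simp only [List.length_append, List.length_cons]; omega)
  · exact Prod.Lex.left _ _ (by simp only [List.length_append]; omega)
  · rename_i hlt
    have h1 := inversions_swap_lt h.choose.1 h.choose.2.2.2 hlt
    rw [← h.choose_spec.1] at h1
    have h2 : (h.choose.1 ++ h.choose.2.2.1 :: h.choose.2.1 :: h.choose.2.2.2).length = w.length :=
      by simp only [List.length_append, List.length_cons]; omega
    rw [h2]
    exact Prod.Lex.right _ h1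
  · exact Prod.Lex.left _ _ (by simp only [List.length_append, List.length_cons]; omega)
  · exact Prod.Lex.left _ _ (by simp only [List.length_append]; omega)

/-- At the position selected by choice, the defining recursion is precisely the vanishing of the
relator. This supplies the hypothesis `red` of `defect_eq_zero`; nothing is known yet about the
other positions. -/
theorem straighten_of_redex [CharZero K] {w : List X} {u v : List X} {x y : X}
    (hw : w = u ++ x :: y :: v) (hr : Redex e x y) :
    ∃ u' x' y' v', w = u' ++ x' :: y' :: v' ∧ Redex e x' y' ∧
      extendWords b (straighten b br ω e nf)
        (word b u' * relator br ω (b x') (b y') (e x' y') * word b v') = 0 := by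
  have h : ∃ r : List X × X × X × List X,
      w = r.1 ++ r.2.1 :: r.2.2.1 :: r.2.2.2 ∧ Redex e r.2.1 r.2.2.1 := ⟨(u, x, y, v), hw, hr⟩
  refine ⟨_, _, _, _, h.choose_spec.1, h.choose_spec.2, ?_⟩
  have hs := straighten.eq_1 b br ω e nf w
  rw [dif_pos h] at hs
  rw [extendWords_relator, ← h.choose_spec.1, hs]
  split_ifs with hlt
  · abel
  · obtain ⟨h1, h2⟩ := h.choose_spec.2.resolve_left hlt
    have h3 : straighten b br ω e nf (h.choose.1 ++ h.choose.2.2.1 :: h.choose.2.1 :: h.choose.2.2.2)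
      = straighten b br ω e nf w := by
      conv_rhs => rw [h.choose_spec.1]
      rw [h1]
    rw [h3, hs, if_neg hlt, h1, h2]
    module

end Words

end ColorLie

end

noncomputable section

/-! ### The straightening map kills the relations of the enveloping algebra -/

namespace ColorLie

/-! ### Identities between relators in the tensor algebra -/

section Relators

variable {K L V : Type*} [Field K] [AddCommGroup L] [Module K L]
  [AddCommGroup V] [Module K V]
variable (br : L →ₗ[K] L →ₗ[K] L) (ω : L →ₗ[K] L →ₗ[K] K)

theorem relator_add_left (a a' c : L) (k : K) :
    relator br ω (a + a') c k = relator br ω a c k + relator br ω a' c k := by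
  simp only [relator, map_add, LinearMap.add_apply, add_mul, mul_add, smul_add]
  abel

theorem relator_add_right (a c c' : L) (k : K) :
    relator br ω a (c + c') k = relator br ω a c k + relator br ω a c' k := by
  simp only [relator, map_add, add_mul, mul_add, smul_add]
  abel

theorem relator_smul_left (r : K) (a c : L) (k : K) :
    relator br ω (r • a) c k = r • relator br ω a c k := by
  simp only [relator, map_smul, LinearMap.smul_apply, smul_mul_assoc, mul_smul_comm,
    Algebra.algebraMap_eq_smul_one, smul_eq_mul]
  module

theorem relator_smul_right (r : K) (a c : L) (k : K) :
    relator br ω a (r • c) k = r • relator br ω a c k := by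
  simp only [relator, map_smul, smul_mul_assoc, mul_smul_comm,
    Algebra.algebraMap_eq_smul_one, smul_eq_mul]
  module

theorem relator_zero_left (c : L) (k : K) : relator br ω 0 c k = 0 := by
  simp [relator]

theorem relator_zero_right (a : L) (k : K) : relator br ω a 0 k = 0 := by
  simp [relator]

variable {br ω}

theorem relator_skew {a c : L} {k k' : K} (hk : k * k' = 1) (hbr : br a c = -(k • br c a))
    (hω : ω a c = -(k * ω c a)) : relator br ω a c k + k • relator br ω c a k' = 0 := by
  simp only [relator, hbr, hω, map_neg, map_smul, Algebra.algebraMap_eq_smul_one]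
  match_scalars
  all_goals first | ring1 | linear_combination hk | linear_combination -hk

/-- The left side compares the two ways of reversing xyz by adjacent swaps. The cubic terms cancel;
by the Jacobi and cocycle identities the rest is a combination of relators with one bracketed entry,
hence of shorter length. The conditions on ω let its scalar values pass the third letter without a
factor. -/
theorem relator_braid {x y z : L} {k l m m' : K} (hm : m * m' = 1)
    (hbr : br x (br y z) = br (br x y) z - m • br (br x z) y)
    (hω : ω x (br y z) = ω (br x y) z - m * ω (br x z) y)
    (hxy : ω x y * (l * m) = ω x y) (hxz : ω x z * (k * m') = ω x z)
    (hyz : ω y z * (k * l) = ω y z) :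
    relator br ω x y k * TensorAlgebra.ι K z + k • (TensorAlgebra.ι K y * relator br ω x z l) +
      (k * l) • (relator br ω y z m * TensorAlgebra.ι K x) -
      (TensorAlgebra.ι K x * relator br ω y z m + m • (relator br ω x z l * TensorAlgebra.ι K y) +
        (m * l) • (TensorAlgebra.ι K z * relator br ω x y k)) =
    m • relator br ω (br x z) y (k * m') + relator br ω x (br y z) (k * l) -
      relator br ω (br x y) z (l * m) := by
  simp only [relator, hbr, hω, map_sub, map_smul, Algebra.algebraMap_eq_smul_one, mul_sub, sub_mul,
    smul_mul_assoc, mul_smul_comm, mul_one, one_mul, mul_assoc]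
  match_scalars
  all_goals first
    | ring1
    | linear_combination hxy
    | linear_combination -hyz
    | linear_combination k * hm
    | linear_combination -m * hxz + ω x z * k * hm

/-- Expanding either factor in the product of the two relators gives the same element, so the
products cancel. Only terms where one pair has been replaced by its bracket or by ω survive, and
these are shorter. -/
theorem relator_comm {x y z t : L} {k l : K} (U M W : TensorAlgebra K L) :
    U * relator br ω x y k * (M * (TensorAlgebra.ι K z * (TensorAlgebra.ι K t * W))) +
      k • ((U * (TensorAlgebra.ι K y * (TensorAlgebra.ι K x * M))) * relator br ω z t l * W) -
      ((U * (TensorAlgebra.ι K x * (TensorAlgebra.ι K y * M))) * relator br ω z t l * W +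
        l • (U * relator br ω x y k *
          (M * (TensorAlgebra.ι K t * (TensorAlgebra.ι K z * W))))) =
    (U * relator br ω x y k * (M * TensorAlgebra.ι K (br z t) * W) +
        ω z t • (U * relator br ω x y k * (M * W))) -
      ((U * TensorAlgebra.ι K (br x y) * M) * relator br ω z t l * W +
        ω x y • ((U * M) * relator br ω z t l * W)) := by
  simp only [relator, Algebra.algebraMap_eq_smul_one, mul_sub, sub_mul,
    smul_mul_assoc, mul_smul_comm, mul_one, mul_assoc]
  module

end Relators

/-! ### Homogeneous bases, and confluence for the relations of the enveloping algebra -/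

section Homogeneous

variable {K G L V X : Type*} [Field K] [AddCommGroup G] [AddCommGroup L] [Module K L]
  [AddCommGroup V] [Module K V]
variable {ε : G → G → Kˣ} {𝓛 : G → Submodule K L} {br : L →ₗ[K] L →ₗ[K] L} {ω : L →ₗ[K] L →ₗ[K] K}

/-- A basis of homogeneous elements, `d x` being the degree of `b x`. -/
structure IsHomogeneousBasis (𝓛 : G → Submodule K L) (b : Module.Basis X K L) (d : X → G) :
    Prop where
  mem : ∀ x, b x ∈ 𝓛 (d x)
  mem_span : ∀ {g a}, a ∈ 𝓛 g → a ∈ Submodule.span K (b '' {x | d x = g})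

theorem exists_isHomogeneousBasis.{u, v, w} {K : Type u} {G : Type v} {L : Type w} [Field K]
    [AddCommGroup L] [Module K L] [DecidableEq G] {𝓛 : G → Submodule K L}
    (h : DirectSum.IsInternal 𝓛) :
    ∃ (X : Type (max v w)) (b : Module.Basis X K L) (d : X → G), IsHomogeneousBasis 𝓛 b d := by
  refine ⟨_, h.collectedBasis fun g => Module.Free.chooseBasis K (𝓛 g), Sigma.fst,
    fun x => h.collectedBasis_mem _ x, fun {g a} ha => ?_⟩
  rw [Module.Basis.mem_span_image]
  rintro ⟨i, j⟩ hx
  by_contra hne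
  rw [Finset.mem_coe, Finsupp.mem_support_iff] at hx
  exact hx (h.collectedBasis_repr_of_mem_ne _ (fun h => hne h.symm) ha)

variable {b : Module.Basis X K L} {d : X → G}

omit [AddCommGroup G] in
-- For fixed degrees the scalar `ε g h` is constant, so the relator is bilinear and basis elements
-- of those degrees suffice.
theorem map_relator_eq_zero (hb : IsHomogeneousBasis 𝓛 b d) (Φ : TensorAlgebra K L →ₗ[K] V)
    (hΦ : ∀ x y, Φ (relator br ω (b x) (b y) (ε (d x) (d y))) = 0) {g h : G} {a c : L}
    (ha : a ∈ 𝓛 g) (hc : c ∈ 𝓛 h) : Φ (relator br ω a c (ε g h)) = 0 := by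
  have ha' := hb.mem_span ha
  have hc' := hb.mem_span hc
  clear ha hc
  induction ha' using Submodule.span_induction with
  | mem a ha =>
    obtain ⟨x, rfl, rfl⟩ := ha
    induction hc' using Submodule.span_induction with
    | mem c hc =>
      obtain ⟨y, rfl, rfl⟩ := hc
      exact hΦ x y
    | zero => rw [relator_zero_right, map_zero]
    | add c c' _ _ h1 h2 => rw [relator_add_right, map_add, h1, h2, add_zero]
    | smul r c _ h1 => rw [relator_smul_right, map_smul, h1, smul_zero]
  | zero => rw [relator_zero_left, map_zero]
  | add c c' _ _ h1 h2 => rw [relator_add_left, map_add, h1, h2, add_zero]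
  | smul r c _ h1 => rw [relator_smul_left, map_smul, h1, smul_zero]

theorem IsAntisymmBicharacter.coe_mul_swap (hε : IsAntisymmBicharacter ε) (g h : G) :
    (ε g h : K) * ε h g = 1 := by
  rw [← Units.val_mul, hε.mul_swap, Units.val_one]

theorem IsAntisymmBicharacter.zero_right (hε : IsAntisymmBicharacter ε) (g : G) : ε g 0 = 1 := by
  simpa using hε.add_right g 0 0

theorem IsAntisymmBicharacter.add_eq_zero (hε : IsAntisymmBicharacter ε) {g h k : G}
    (hgh : g + h = 0) : (ε k g : K) * ε k h = 1 := by
  rw [← Units.val_mul, ← hε.add_right, hgh, hε.zero_right, Units.val_one]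

theorem IsAntisymmBicharacter.coe_swap (hε : IsAntisymmBicharacter ε) (g h : G) :
    (ε g h : K) = (ε h g : K)⁻¹ :=
  eq_inv_of_mul_eq_one_left (hε.coe_mul_swap g h)

variable [DecidableEq G]

/-- The Jacobi identity in its derivation form. -/
theorem IsColorLieAlgebra.leibniz (hε : IsAntisymmBicharacter ε)
    (hL : IsColorLieAlgebra ε 𝓛 br) {g h k : G} {x y z : L} (hx : x ∈ 𝓛 g) (hy : y ∈ 𝓛 h)
    (hz : z ∈ 𝓛 k) : br x (br y z) = br (br x y) z - (ε h k : K) • br (br x z) y := by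
  have hJ := hL.jacobi hx hy hz
  rw [hL.skew (hL.bracket_mem hx hy) hz, hL.skew (hL.bracket_mem hx hz) hy, hL.skew hx hz, map_neg,
    map_smul, hε.add_left, hε.add_left]
  -- The factor `ε g k` is the inverse of the coefficient `ε k g` of the term to be isolated.
  have hJ' := congrArg (fun t => (ε g k : K) • t) hJ
  simp only [smul_add, smul_zero, smul_smul, hε.coe_mul_swap, one_smul] at hJ'
  push_cast
  have h1 : (ε h k : K) * ε k h = 1 := hε.coe_mul_swap h k
  have hA : br x (br y z) = -(((ε g k : K) * ε g h) • br y (br z x)) -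
      ((ε g k : K) * ε h k) • br z (br x y) := by
    linear_combination (norm := module) hJ'
  rw [hA]
  match_scalars
  · linear_combination (ε g k : K) * ε g h * h1
  · ring

theorem IsScalarTwoCocycle.leibniz (hε : IsAntisymmBicharacter ε)
    (hL : IsColorLieAlgebra ε 𝓛 br) (hω : IsScalarTwoCocycle ε 𝓛 br ω) {g h k : G} {x y z : L}
    (hx : x ∈ 𝓛 g) (hy : y ∈ 𝓛 h) (hz : z ∈ 𝓛 k) :
    ω x (br y z) = ω (br x y) z - (ε h k : K) * ω (br x z) y := by
  have hJ := hω.cocycle hx hy hz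
  rw [hω.skew (hL.bracket_mem hx hy) hz, hω.skew (hL.bracket_mem hx hz) hy, hL.skew hx hz, map_neg,
    map_smul, hε.add_left, hε.add_left]
  push_cast
  have h1 : (ε h k : K) * ε k h = 1 := hε.coe_mul_swap h k
  have h2 : (ε g k : K) * ε k g = 1 := hε.coe_mul_swap g k
  simp only [smul_eq_mul]
  linear_combination (ε g k : K) * hJ - ω x (br y z) * h2 +
    (ε g k : K) * ε g h * ω y (br z x) * h1

/-- Either the degrees of `x` and `y` cancel, and the bicharacter factors multiply to 1, or `ω x y`
is zero. -/
theorem IsScalarTwoCocycle.mul_bicharacter (hε : IsAntisymmBicharacter ε)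
    (hω : IsScalarTwoCocycle ε 𝓛 br ω) {g h : G} {x y : L} (hx : x ∈ 𝓛 g) (hy : y ∈ 𝓛 h)
    (k : G) : ω x y * ((ε g k : K) * ε h k) = ω x y ∧ ω x y * ((ε k g : K) * ε k h) = ω x y := by
  by_cases hgh : g + h = 0
  · have h1 : (ε k g : K) * ε k h = 1 := hε.add_eq_zero hgh
    refine ⟨?_, by rw [h1, mul_one]⟩
    rw [hε.coe_swap g k, hε.coe_swap h k, ← mul_inv, h1, inv_one, mul_one]
  · rw [hω.degree_zero hx hy hgh]
    simp

variable [LinearOrder X] [CharZero K]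

/-- Induction on word length: the error terms in the commutation and braid identities are relators
in shorter words, already killed, so `defect_eq_zero` applies at each length. -/
theorem extendWords_straighten_relator (hε : IsAntisymmBicharacter ε)
    (hL : IsColorLieAlgebra ε 𝓛 br) (hω : IsScalarTwoCocycle ε 𝓛 br ω)
    (hb : IsHomogeneousBasis 𝓛 b d) (nf : List X → V) {g h : G} {a c : L}
    (ha : a ∈ 𝓛 g) (hc : c ∈ 𝓛 h) (s t : TensorAlgebra K L) :
    extendWords b (straighten b br ω (fun x y => (ε (d x) (d y) : K)) nf)
      (s * relator br ω a c (ε g h) * t) = 0 := by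
  set Φ := extendWords b (straighten b br ω (fun x y => (ε (d x) (d y) : K)) nf) with hΦ
  have main : ∀ n : ℕ, ∀ u x y v, u.length + v.length + 2 = n →
      Φ (word b u * relator br ω (b x) (b y) (ε (d x) (d y)) * word b v) = 0 := by
    intro n
    induction n using Nat.strong_induction_on with
    | _ n ih =>
    have ih' : ∀ u v, u.length + v.length + 2 < n → ∀ {g h : G} {a c : L}, a ∈ 𝓛 g → c ∈ 𝓛 h →
        Φ (word b u * relator br ω a c (ε g h) * word b v) = 0 := by
      intro u v hn g h a c ha hc
      exact map_relator_eq_zero hb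
        (Φ ∘ₗ LinearMap.mulRight K (word b v) ∘ₗ LinearMap.mulLeft K (word b u))
        (fun x y => ih _ hn u x y v rfl) ha hc
    refine defect_eq_zero (fun x y => (ε (d x) (d y) : K)) (fun x y => hε.coe_mul_swap _ _) n
      (fun u x y v => Φ (word b u * relator br ω (b x) (b y) (ε (d x) (d y)) * word b v))
      ?_ ?_ ?_ ?_
    · intro u x y v _
      rw [← map_smul, ← map_add, ← smul_mul_assoc, ← mul_smul_comm, ← add_mul, ← mul_add,
        relator_skew (hε.coe_mul_swap _ _) (hL.skew (hb.mem x) (hb.mem y))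
          (hω.skew (hb.mem x) (hb.mem y)), mul_zero, zero_mul, map_zero]
    · intro u x y m z t v hn
      rw [← sub_eq_zero, ← map_smul, ← map_smul, ← map_add, ← map_add, ← map_sub]
      simp only [word_append, word_cons]
      rw [relator_comm, map_sub, map_add, map_add, map_smul, map_smul]
      -- By linearity in `l`, a basis letter `r` may take the place of `[z,t]`; the resulting words
      -- have total length n - 1.
      have h1 : ∀ l : L, Φ (word b u * relator br ω (b x) (b y) (ε (d x) (d y)) *
          (word b m * TensorAlgebra.ι K l * word b v)) = 0 := by
        intro l
        refine LinearMap.congr_fun (f := Φ ∘ₗ LinearMap.mulLeft K (word b u *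
          relator br ω (b x) (b y) (ε (d x) (d y))) ∘ₗ LinearMap.mulRight K (word b v) ∘ₗ
            LinearMap.mulLeft K (word b m) ∘ₗ TensorAlgebra.ι K) (g := 0) (b.ext fun r => ?_) l
        have := ih' u (m ++ r :: v) (by simp; omega) (hb.mem x) (hb.mem y)
        simpa [mul_assoc] using this
      have h2 : ∀ l : L, Φ (word b u * TensorAlgebra.ι K l * word b m *
          relator br ω (b z) (b t) (ε (d z) (d t)) * word b v) = 0 := by
        intro l
        refine LinearMap.congr_fun (f := Φ ∘ₗ LinearMap.mulRight K (word b v) ∘ₗ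
          LinearMap.mulRight K (relator br ω (b z) (b t) (ε (d z) (d t))) ∘ₗ
          LinearMap.mulRight K (word b m) ∘ₗ
            LinearMap.mulLeft K (word b u) ∘ₗ TensorAlgebra.ι K) (g := 0) (b.ext fun r => ?_) l
        have := ih' (u ++ r :: m) v (by simp; omega) (hb.mem z) (hb.mem t)
        simpa [mul_assoc] using this
      have h3 := ih' u (m ++ v) (by simp; omega) (hb.mem x) (hb.mem y)
      have h4 := ih' (u ++ m) v (by simp; omega) (hb.mem z) (hb.mem t)
      rw [word_append] at h3 h4
      rw [h1, h2, h3, h4]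
      simp
    · intro u x y z v hn
      have hB := relator_braid (br := br) (ω := ω) (hε.coe_mul_swap (d y) (d z))
        (hL.leibniz hε (hb.mem x) (hb.mem y) (hb.mem z))
        (hω.leibniz hε hL (hb.mem x) (hb.mem y) (hb.mem z))
        (hω.mul_bicharacter hε (hb.mem x) (hb.mem y) (d z)).1
        (hω.mul_bicharacter hε (hb.mem x) (hb.mem z) (d y)).1
        (hω.mul_bicharacter hε (hb.mem y) (hb.mem z) (d x)).2
      have h1 := ih' u v (by omega) (hL.bracket_mem (hb.mem x) (hb.mem z)) (hb.mem y)
      have h2 := ih' u v (by omega) (hb.mem x) (hL.bracket_mem (hb.mem y) (hb.mem z))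
      have h3 := ih' u v (by omega) (hL.bracket_mem (hb.mem x) (hb.mem y)) (hb.mem z)
      rw [hε.add_left, Units.val_mul] at h1 h3
      rw [hε.add_right, Units.val_mul] at h2
      have hB' := congrArg (fun r => Φ (word b u * r * word b v)) hB
      simp only [mul_add, add_mul, mul_sub, sub_mul, map_add, map_sub, mul_smul_comm,
        smul_mul_assoc, map_smul, h1, h2, h3, smul_zero, sub_zero, add_zero] at hB'
      rw [sub_eq_zero] at hB'
      simpa [mul_assoc] using hB'
    · intro u x y v _ hr
      exact straighten_of_redex b br ω _ nf rfl hr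
  refine map_relator_eq_zero hb
    (Φ ∘ₗ LinearMap.mulRight K t ∘ₗ LinearMap.mulLeft K s) (fun x y => ?_) ha hc
  refine LinearMap.congr_fun (f := Φ ∘ₗ LinearMap.mulRight K t ∘ₗ
    LinearMap.mulRight K (relator br ω (b x) (b y) (ε (d x) (d y)))) (g := 0)
    (b.tensorAlgebra.ext fun u => ?_) s
  refine LinearMap.congr_fun (f := Φ ∘ₗ LinearMap.mulLeft K
    (b.tensorAlgebra u * relator br ω (b x) (b y) (ε (d x) (d y)))) (g := 0)
    (b.tensorAlgebra.ext fun v => ?_) t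
  have := main _ u.toList x y v.toList rfl
  simpa [tensorAlgebra_basis_apply, mul_assoc] using this

end Homogeneous

end ColorLie

end

noncomputable section

/-! ### Straightening descends to the enveloping algebra and respects leading terms -/

namespace ColorLie

section Descent

/-- A linear map on an algebra which kills the two-sided ideal generated by the relations is
constant on the fibres of the quotient map. -/
theorem eq_of_mkAlgHom_eq {K A V : Type*} [CommRing K] [Ring A] [Algebra K A] [AddCommGroup V]
    [Module K V] {r : A → A → Prop} (Φ : A →ₗ[K] V)
    (hΦ : ∀ x y, r x y → ∀ s t, Φ (s * x * t) = Φ (s * y * t)) {x y : A}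
    (h : RingQuot.mkAlgHom K r x = RingQuot.mkAlgHom K r y) : Φ x = Φ y := by
  have h1 : RingQuot.mkRingHom r x = RingQuot.mkRingHom r y := by
    rw [← RingQuot.mkAlgHom_coe K]
    exact h
  simp only [RingQuot.mkRingHom_def] at h1
  -- Equality in the quotient is the equivalence closure of `RingQuot.Rel`. Carrying arbitrary
  -- factors `s`, `t` on both sides makes the induction pass through products.
  have h2 := Quot.eqvGen_exact (congrArg RingQuot.toQuot h1)
  have h3 : ∀ {x y}, RingQuot.Rel r x y → ∀ s t, Φ (s * x * t) = Φ (s * y * t) := by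
    intro x y hxy
    induction hxy with
    | of h => exact hΦ _ _ h
    | add_left _ ih => intro s t; simp only [mul_add, add_mul, map_add, ih]
    | @mul_left a b c _ ih => intro s t; simpa [mul_assoc] using ih s (c * t)
    | @mul_right a b c _ ih => intro s t; simpa [mul_assoc] using ih (s * a) t
  clear h h1
  induction h2 with
  | rel _ _ h => simpa using h3 h 1 1
  | refl => rfl
  | symm _ _ _ ih => exact ih.symm
  | trans _ _ _ _ _ ih1 ih2 => exact ih1.trans ih2

variable {K G L X : Type*} [Field K] [AddCommGroup G] [AddCommGroup L] [Module K L]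

theorem range_ι_pow_le (b : Module.Basis X K L) (n : ℕ) :
    LinearMap.range (TensorAlgebra.ι K (M := L)) ^ n ≤
      Submodule.span K (word b '' {w | w.length = n}) := by
  induction n with
  | zero =>
    rw [pow_zero, Submodule.one_eq_span]
    exact Submodule.span_mono (Set.singleton_subset_iff.2 ⟨[], rfl, rfl⟩)
  | succ n ih =>
    rw [pow_succ', Submodule.mul_le]
    rintro _ ⟨a, rfl⟩ t ht
    replace ht := ih ht
    have ha := b.mem_span a
    induction ha using Submodule.span_induction with
    | mem a ha =>
      obtain ⟨x, rfl⟩ := ha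
      induction ht using Submodule.span_induction with
      | mem t ht =>
        obtain ⟨w, hw, rfl⟩ := ht
        exact Submodule.subset_span ⟨x :: w, congrArg (· + 1) hw, by simp⟩
      | zero => simp
      | add t t' _ _ h1 h2 => rw [mul_add]; exact add_mem h1 h2
      | smul r t _ h1 => rw [mul_smul_comm]; exact Submodule.smul_mem _ _ h1
    | zero => simp
    | add t t' _ _ h1 h2 => rw [map_add, add_mul]; exact add_mem h1 h2
    | smul r t _ h1 => rw [map_smul, smul_mul_assoc]; exact Submodule.smul_mem _ _ h1

theorem word_mem (b : Module.Basis X K L) (w : List X) :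
    word b w ∈ LinearMap.range (TensorAlgebra.ι K (M := L)) ^ w.length := by
  induction w with
  | nil => simp
  | cons x w ih =>
    rw [word_cons, List.length_cons, pow_succ']
    exact Submodule.mul_mem_mul (LinearMap.mem_range_self _ _) ih

section

omit [AddCommGroup G]

variable (ε : G → G → Kˣ) (𝓛 : G → Submodule K L) (br : L →ₗ[K] L →ₗ[K] L)
  (ω : L →ₗ[K] L →ₗ[K] K)

theorem envFiltration_mono : Monotone (envFiltration ε 𝓛 br ω) := fun _ _ h =>
  IsFiltration.mono (F := envFiltration ε 𝓛 br ω) h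

theorem envMk_mem_envFiltration {n : ℕ} {m : ℤ} (h : (n : ℤ) ≤ m) {t : TensorAlgebra K L}
    (ht : t ∈ LinearMap.range (TensorAlgebra.ι K (M := L)) ^ n) :
    envMk ε 𝓛 br ω t ∈ envFiltration ε 𝓛 br ω m :=
  ⟨t, pow_le_tensorFiltration h ht, rfl⟩

end

variable {ε : G → G → Kˣ} {𝓛 : G → Submodule K L} {br : L →ₗ[K] L →ₗ[K] L} {ω : L →ₗ[K] L →ₗ[K] K}
variable {b : Module.Basis X K L} {d : X → G} [DecidableEq G] [LinearOrder X] [CharZero K]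

/-- The straightening map `T(L) → S(L)`, which is the canonical map on irreducible words. -/
def straightenMap (ε : G → G → Kˣ) (𝓛 : G → Submodule K L) (br : L →ₗ[K] L →ₗ[K] L)
    (ω : L →ₗ[K] L →ₗ[K] K) (b : Module.Basis X K L) (d : X → G) :
    TensorAlgebra K L →ₗ[K] SymAlg ε 𝓛 :=
  extendWords b (straighten b br ω (fun x y => (ε (d x) (d y) : K))
    fun w => envMk ε 𝓛 0 0 (word b w))

theorem straightenMap_eq_of_envMk_eq (hε : IsAntisymmBicharacter ε)
    (hL : IsColorLieAlgebra ε 𝓛 br) (hω : IsScalarTwoCocycle ε 𝓛 br ω)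
    (hb : IsHomogeneousBasis 𝓛 b d) {x y : TensorAlgebra K L}
    (h : envMk ε 𝓛 br ω x = envMk ε 𝓛 br ω y) :
    straightenMap ε 𝓛 br ω b d x = straightenMap ε 𝓛 br ω b d y := by
  refine eq_of_mkAlgHom_eq _ ?_ h
  rintro _ _ ⟨ha, hc⟩ s t
  rw [mul_zero, zero_mul, map_zero]
  exact extendWords_straighten_relator hε hL hω hb _ ha hc s t

/-- The straightening map and the projection to `S(L)` obey the same rewriting rule up to lower
order, and they agree on irreducible words. The bound is an integer, so for the empty word the
difference lies in degree -1 and is zero. -/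
theorem straightenMap_word_sub_mem (hε : IsAntisymmBicharacter ε)
    (hL : IsColorLieAlgebra ε 𝓛 br) (hω : IsScalarTwoCocycle ε 𝓛 br ω)
    (hb : IsHomogeneousBasis 𝓛 b d) (w : List X) :
    straightenMap ε 𝓛 br ω b d (word b w) - envMk ε 𝓛 0 0 (word b w) ∈
      envFiltration ε 𝓛 0 0 (w.length - 1) := by
  set Φ := straightenMap ε 𝓛 br ω b d with hΦ
  obtain ⟨n, hn⟩ : ∃ n, w.length = n := ⟨_, rfl⟩
  induction n using Nat.strong_induction_on generalizing w with
  | _ n ih =>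
  obtain ⟨N, hN⟩ : ∃ N, inversions w = N := ⟨_, rfl⟩
  induction N using Nat.strong_induction_on generalizing w with
  | _ N ihN =>
  have low : ∀ w : List X, w.length < n → Φ (word b w) ∈ envFiltration ε 𝓛 0 0 (n - 1) := by
    intro w hw
    have h1 := envFiltration_mono ε 𝓛 0 0 (by omega : (w.length : ℤ) - 1 ≤ n - 1) (ih _ hw w rfl)
    have h2 := envMk_mem_envFiltration ε 𝓛 0 0 (by omega : (w.length : ℤ) ≤ n - 1) (word_mem b w)
    simpa using add_mem h1 h2
  by_cases hr : ∃ r : List X × X × X × List X, w = r.1 ++ r.2.1 :: r.2.2.1 :: r.2.2.2 ∧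
      Redex (fun x y => (ε (d x) (d y) : K)) r.2.1 r.2.2.1
  · obtain ⟨⟨u, x, y, v⟩, rfl, hr⟩ := hr
    dsimp only at hr hn hN ⊢
    simp only [List.length_append, List.length_cons] at hn
    have h1 := extendWords_straighten_relator hε hL hω hb
      (fun w => envMk ε 𝓛 0 0 (word b w)) (hb.mem x) (hb.mem y) (word b u) (word b v)
    have h2 : envMk ε 𝓛 0 0 (word b u * (TensorAlgebra.ι K (b x) * TensorAlgebra.ι K (b y) -
        (ε (d x) (d y) : K) • (TensorAlgebra.ι K (b y) * TensorAlgebra.ι K (b x))) *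
          word b v) = 0 := by
      have := envι_rel ε 𝓛 0 0 (hb.mem x) (hb.mem y)
      simp only [LinearMap.zero_apply, map_zero, add_zero] at this
      rw [map_mul, map_mul, map_sub, map_smul, map_mul, map_mul]
      change _ * (envι ε 𝓛 0 0 (b x) * envι ε 𝓛 0 0 (b y) - (ε (d x) (d y) : K) •
        (envι ε 𝓛 0 0 (b y) * envι ε 𝓛 0 0 (b x))) * _ = 0
      rw [this, mul_zero, zero_mul]
    change Φ _ = 0 at h1
    have h3 : Φ (word b u * TensorAlgebra.ι K (br (b x) (b y)) * word b v) ∈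
        envFiltration ε 𝓛 0 0 (n - 1) := by
      rw [hΦ, straightenMap, extendWords_word_ι_word]
      refine Submodule.sum_mem _ fun z _ => Submodule.smul_mem _ _ ?_
      have := low (u ++ z :: v) (by simp; omega)
      rwa [hΦ, straightenMap, extendWords_word] at this
    have h4 : ω (b x) (b y) • Φ (word b (u ++ v)) ∈ envFiltration ε 𝓛 0 0 (n - 1) :=
      Submodule.smul_mem _ _ (low _ (by simp; omega))
    -- Subtracting the relation in `S(L)` from the one satisfied by `Φ` leaves only the values on
    -- shorter words.
    have h5 : (Φ (word b (u ++ x :: y :: v)) - envMk ε 𝓛 0 0 (word b (u ++ x :: y :: v))) -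
        (ε (d x) (d y) : K) • (Φ (word b (u ++ y :: x :: v)) -
          envMk ε 𝓛 0 0 (word b (u ++ y :: x :: v))) =
        Φ (word b u * TensorAlgebra.ι K (br (b x) (b y)) * word b v) +
          ω (b x) (b y) • Φ (word b (u ++ v)) := by
      simp only [relator, mul_sub, sub_mul, Algebra.algebraMap_eq_smul_one, mul_smul_comm,
        smul_mul_assoc, map_sub, map_smul, mul_one] at h1 h2
      simp only [word_append, word_cons, ← mul_assoc] at h1 h2 ⊢
      linear_combination (norm := module) h1 - h2
    have h6 := add_mem h3 h4
    rw [← h5] at h6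
    have hlen : (((u ++ x :: y :: v).length : ℕ) : ℤ) - 1 = n - 1 := by
      simp only [List.length_append, List.length_cons]; omega
    rw [hlen]
    rcases hr with hlt | ⟨rfl, hodd⟩
    · have h7 := ihN _ (hN ▸ inversions_swap_lt u v hlt) (u ++ y :: x :: v) (by simp; omega) rfl
      rw [show (((u ++ y :: x :: v).length : ℕ) : ℤ) - 1 = n - 1 by
        simp only [List.length_append, List.length_cons]; omega] at h7
      simpa using add_mem h6 (Submodule.smul_mem _ (ε (d x) (d y) : K) h7)
    -- For an odd square the swapped word is the same, so twice the difference has lower order.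
    · beta_reduce at hodd
      rw [hodd, neg_one_smul, sub_neg_eq_add, ← two_smul K] at h6
      exact (Submodule.smul_mem_iff _ two_ne_zero).1 h6
  · rw [hΦ, straightenMap, extendWords_word, straighten.eq_1, dif_neg hr, sub_self]
    exact zero_mem _

theorem straightenMap_sub_mem (hε : IsAntisymmBicharacter ε)
    (hL : IsColorLieAlgebra ε 𝓛 br) (hω : IsScalarTwoCocycle ε 𝓛 br ω)
    (hb : IsHomogeneousBasis 𝓛 b d) {n : ℕ} {t : TensorAlgebra K L}
    (ht : t ∈ LinearMap.range (TensorAlgebra.ι K (M := L)) ^ n) :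
    straightenMap ε 𝓛 br ω b d t - envMk ε 𝓛 0 0 t ∈ envFiltration ε 𝓛 0 0 (n - 1) := by
  have h : Submodule.span K (word b '' {w | w.length = n}) ≤ (envFiltration ε 𝓛 0 0 (n - 1)).comap
      (straightenMap ε 𝓛 br ω b d - (envMk ε 𝓛 0 0).toLinearMap) := by
    rw [Submodule.span_le]
    rintro _ ⟨w, rfl, rfl⟩
    exact straightenMap_word_sub_mem hε hL hω hb w
  exact h (range_ι_pow_le b n ht)

theorem straightenMap_mem (hε : IsAntisymmBicharacter ε)
    (hL : IsColorLieAlgebra ε 𝓛 br) (hω : IsScalarTwoCocycle ε 𝓛 br ω)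
    (hb : IsHomogeneousBasis 𝓛 b d) {n : ℤ} {t : TensorAlgebra K L}
    (ht : t ∈ tensorFiltration K L n) :
    straightenMap ε 𝓛 br ω b d t ∈ envFiltration ε 𝓛 0 0 n := by
  have h : tensorFiltration K L n ≤
      (envFiltration ε 𝓛 0 0 n).comap (straightenMap ε 𝓛 br ω b d) := by
    refine iSup₂_le fun m hm t ht => ?_
    have h1 := envFiltration_mono ε 𝓛 0 0 (by omega : (m : ℤ) - 1 ≤ n)
      (straightenMap_sub_mem hε hL hω hb ht)
    simpa using add_mem h1 (envMk_mem_envFiltration ε 𝓛 0 0 hm ht)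
  exact h ht

omit [LinearOrder X] in
/-- A homogeneous tensor which becomes of lower order in the enveloping algebra also becomes of
lower order in the symmetric algebra. -/
theorem envMk_sym_mem_of_envMk_mem (hε : IsAntisymmBicharacter ε)
    (hL : IsColorLieAlgebra ε 𝓛 br) (hω : IsScalarTwoCocycle ε 𝓛 br ω)
    {n : ℕ} {t : TensorAlgebra K L} (ht : t ∈ LinearMap.range (TensorAlgebra.ι K (M := L)) ^ n)
    (h : envMk ε 𝓛 br ω t ∈ envFiltration ε 𝓛 br ω (n - 1)) :
    envMk ε 𝓛 0 0 t ∈ envFiltration ε 𝓛 0 0 (n - 1) := by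
  classical
  obtain ⟨X, b, d, hb⟩ := exists_isHomogeneousBasis hL.isInternal
  -- Any linear order on the basis will do; termination rests on length and inversions, not on
  -- well-foundedness of the order.
  let _ : LinearOrder X := linearOrderOfSTO WellOrderingRel
  obtain ⟨t', ht', he⟩ := h
  have h1 := straightenMap_eq_of_envMk_eq hε hL hω hb (x := t') (y := t) he
  have h2 := straightenMap_mem hε hL hω hb ht'
  have h3 := straightenMap_sub_mem hε hL hω hb ht
  rw [h1] at h2
  simpa using sub_mem h2 h3

end Descent

end ColorLie

end

noncomputable section

/-! ### Gradings of the enveloping algebra and of the symmetric algebra -/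

namespace ColorLie

theorem iSupIndep_of_projections {K M ι : Type*} [Semiring K] [AddCommMonoid M] [Module K M]
    (A : ι → Submodule K M) (π : ι → M →ₗ[K] M) (h1 : ∀ i, ∀ x ∈ A i, π i x = x)
    (h2 : ∀ i j, i ≠ j → ∀ x ∈ A j, π i x = 0) : iSupIndep A := by
  intro i
  rw [Submodule.disjoint_def]
  intro x hx hx'
  have h3 : ⨆ (j) (_ : j ≠ i), A j ≤ LinearMap.ker (π i) :=
    iSup₂_le fun j hj x hx => h2 i j hj.symm x hx
  rw [← h1 i x hx]
  exact h3 hx'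

section TensorGrading

variable {K G L X : Type*} [Field K] [AddCommGroup G] [AddCommGroup L] [Module K L]
  {𝓛 : G → Submodule K L}

/-- The grading of the tensor algebra is the smallest family of subspaces which contains `1` and is
stable under left multiplication by homogeneous elements of `L`. -/
theorem tensorGrading_le {N : ℤ × G → Submodule K (TensorAlgebra K L)} (h1 : 1 ∈ N 0)
    (hι : ∀ (g : G) (p : ℤ × G) (a : L) (t : TensorAlgebra K L), a ∈ 𝓛 g → t ∈ N p →
      TensorAlgebra.ι K a * t ∈ N ((1, g) + p)) (p : ℤ × G) : tensorGrading 𝓛 p ≤ N p := by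
  refine Submodule.span_le.2 ?_
  rintro _ ⟨n, a, d, ha, rfl, rfl⟩
  induction n with
  | zero => simpa using! h1
  | succ n ih =>
    have := hι (d 0) _ (a 0) _ (ha 0) (ih (fun i => a i.succ) (fun i => d i.succ) fun i => ha _)
    rw [TensorAlgebra.tprod_apply] at this ⊢
    rw [List.ofFn_succ, List.prod_cons, Fin.sum_univ_succ]
    rwa [Prod.mk_add_mk, show (1 : ℤ) + n = (n + 1 : ℕ) by push_cast; ring] at this

theorem one_mem_tensorGrading : 1 ∈ tensorGrading 𝓛 0 :=
  Submodule.subset_span ⟨0, Fin.elim0, Fin.elim0, fun i => i.elim0, by simp, by simp⟩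

theorem ι_mul_mem_tensorGrading {g : G} {p : ℤ × G} {a : L} {t : TensorAlgebra K L}
    (ha : a ∈ 𝓛 g) (ht : t ∈ tensorGrading 𝓛 p) :
    TensorAlgebra.ι K a * t ∈ tensorGrading 𝓛 ((1, g) + p) := by
  have h : tensorGrading 𝓛 p ≤ (tensorGrading 𝓛 ((1, g) + p)).comap
      (LinearMap.mulLeft K (TensorAlgebra.ι K a)) := by
    refine Submodule.span_le.2 ?_
    rintro _ ⟨n, c, d, hc, rfl, rfl⟩
    refine Submodule.subset_span ⟨n + 1, Fin.cons a c, Fin.cons g d, ?_, ?_, ?_⟩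
    · intro i
      refine Fin.cases ?_ (fun i => ?_) i
      · simpa using ha
      · simpa using hc i
    · rw [Fin.sum_univ_succ]
      simp [add_comm]
    · simp [List.ofFn_succ]
  exact h ht

instance : SetLike.GradedMonoid (tensorGrading 𝓛) where
  one_mem := one_mem_tensorGrading
  mul_mem := by
    intro p q s t hs ht
    refine tensorGrading_le (𝓛 := 𝓛)
      (N := fun p => (tensorGrading 𝓛 (p + q)).comap (LinearMap.mulRight K t)) ?_ ?_ p hs
    · simpa using ht
    · intro g p a s ha hs
      have := ι_mul_mem_tensorGrading ha hs
      simpa [mul_assoc, add_assoc] using this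

theorem range_ι_pow_le_iSup_tensorGrading {b : Module.Basis X K L} {d : X → G}
    (hb : IsHomogeneousBasis 𝓛 b d) (n : ℕ) :
    LinearMap.range (TensorAlgebra.ι K (M := L)) ^ n ≤ ⨆ g, tensorGrading 𝓛 (n, g) := by
  have h : ∀ w : List X, word b w ∈ tensorGrading 𝓛 (w.length, (w.map d).sum) := by
    intro w
    induction w with
    | nil => exact one_mem_tensorGrading
    | cons x w ih =>
      have := ι_mul_mem_tensorGrading (hb.mem x) ih
      rwa [Prod.mk_add_mk, add_comm (1 : ℤ)] at this
  refine (range_ι_pow_le b n).trans (Submodule.span_le.2 ?_)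
  rintro _ ⟨w, rfl, rfl⟩
  exact Submodule.mem_iSup_of_mem _ (h w)

theorem iSup_range_ι_pow :
    ⨆ n : ℕ, LinearMap.range (TensorAlgebra.ι K (M := L)) ^ n = ⊤ :=
  (DirectSum.Decomposition.isInternal (fun n : ℕ =>
    LinearMap.range (TensorAlgebra.ι K (M := L)) ^ n)).submodule_iSup_eq_top

end TensorGrading

/-! ### Coactions and the projections they define -/

section Projections

variable {K G L Γ : Type*} [Field K] [AddCommGroup G] [AddCommGroup L] [Module K L] [DecidableEq G]
  [AddCommMonoid Γ]
  {ε : G → G → Kˣ} {𝓛 : G → Submodule K L} {br : L →ₗ[K] L →ₗ[K] L} {ω : L →ₗ[K] L →ₗ[K] K}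

/-- If the relations are homogeneous for the degree `q`, then the enveloping algebra coacts on
itself by `a ↦ a ⊗ q(g)`, for `a` of degree `g`. -/
theorem exists_coaction (h𝓛 : DirectSum.IsInternal 𝓛) (q : G → Γ)
    (hbr : ∀ g h a c, a ∈ 𝓛 g → c ∈ 𝓛 h →
      br a c = 0 ∨ br a c ∈ 𝓛 (g + h) ∧ q (g + h) = q g + q h)
    (hω : ∀ g h a c, a ∈ 𝓛 g → c ∈ 𝓛 h → ω a c = 0 ∨ q g + q h = 0) :
    ∃ δ : GenEnv ε 𝓛 br ω →ₐ[K] AddMonoidAlgebra (GenEnv ε 𝓛 br ω) Γ,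
      ∀ g, ∀ a ∈ 𝓛 g, δ (envι ε 𝓛 br ω a) = AddMonoidAlgebra.single (q g) (envι ε 𝓛 br ω a) := by
  obtain ⟨X, b, d, hb⟩ := exists_isHomogeneousBasis h𝓛
  set θ : L →ₗ[K] AddMonoidAlgebra (GenEnv ε 𝓛 br ω) Γ := b.constr K fun x =>
    AddMonoidAlgebra.single (q (d x)) (envι ε 𝓛 br ω (b x)) with hθ
  have hθ' : ∀ g, ∀ a ∈ 𝓛 g, θ a = AddMonoidAlgebra.single (q g) (envι ε 𝓛 br ω a) := by
    intro g a ha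
    have h : Submodule.span K (b '' {x | d x = g}) ≤ LinearMap.eqLocus θ
        (AddMonoidAlgebra.lsingle (q g) ∘ₗ envι ε 𝓛 br ω) := by
      refine Submodule.span_le.2 ?_
      rintro _ ⟨x, rfl, rfl⟩
      exact b.constr_basis K _ x
    exact h (hb.mem_span ha)
  refine ⟨RingQuot.liftAlgHom K ⟨TensorAlgebra.lift K θ, ?_⟩, ?_⟩
  · rintro _ _ ⟨ha, hc⟩
    rename_i g h a c
    simp only [map_sub, map_mul, map_smul, TensorAlgebra.lift_ι_apply, AlgHom.commutes, map_zero]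
    rw [hθ' g a ha, hθ' h c hc, AddMonoidAlgebra.single_mul_single,
      AddMonoidAlgebra.single_mul_single, add_comm (q h), AddMonoidAlgebra.smul_single,
      ← AddMonoidAlgebra.single_sub, envι_rel ε 𝓛 br ω ha hc, AddMonoidAlgebra.single_add]
    -- The weight `q` need not be additive: with all of `L` in order 1 it is not, and then the
    -- bracket has to vanish.
    have h1 : θ (br a c) = AddMonoidAlgebra.single (q g + q h) (envι ε 𝓛 br ω (br a c)) := by
      rcases hbr g h a c ha hc with h0 | ⟨h1, h2⟩
      · rw [h0, map_zero, map_zero, AddMonoidAlgebra.single_zero]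
      · rw [hθ' _ _ h1, h2]
    have h2 : algebraMap K (AddMonoidAlgebra (GenEnv ε 𝓛 br ω) Γ) (ω a c) =
        AddMonoidAlgebra.single (q g + q h) (algebraMap K _ (ω a c)) := by
      rcases hω g h a c ha hc with h0 | h0
      · rw [h0, map_zero, map_zero, AddMonoidAlgebra.single_zero]
      · rw [h0]
        rfl
    rw [h1, h2]
    abel
  · intro g a ha
    rw [← hθ' g a ha]
    exact (RingQuot.liftAlgHom_mkAlgHom_apply K _ _ _).trans (TensorAlgebra.lift_ι_apply _ _)

/-- If the relations are homogeneous for the degree `Q`, then the enveloping algebra has projections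
onto the subspaces of given degree. -/
theorem exists_projections [DecidableEq Γ] (h𝓛 : DirectSum.IsInternal 𝓛) (Q : ℤ × G →+ Γ)
    (hbr : ∀ g h a c, a ∈ 𝓛 g → c ∈ 𝓛 h →
      br a c = 0 ∨ br a c ∈ 𝓛 (g + h) ∧ Q (1, g + h) = Q (1, g) + Q (1, h))
    (hω : ∀ g h a c, a ∈ 𝓛 g → c ∈ 𝓛 h → ω a c = 0 ∨ Q (1, g) + Q (1, h) = 0) :
    ∃ π : Γ → GenEnv ε 𝓛 br ω →ₗ[K] GenEnv ε 𝓛 br ω, ∀ γ p, ∀ t ∈ tensorGrading 𝓛 p,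
      π γ (envMk ε 𝓛 br ω t) = if Q p = γ then envMk ε 𝓛 br ω t else 0 := by
  obtain ⟨δ, hδ⟩ := exists_coaction (ε := ε) (br := br) (ω := ω) h𝓛 (fun g => Q (1, g)) hbr hω
  refine ⟨fun γ => Finsupp.lapply γ ∘ₗ (AddMonoidAlgebra.coeffLinearEquiv K).toLinearMap ∘ₗ
    δ.toLinearMap, fun γ p t ht => ?_⟩
  have h : δ (envMk ε 𝓛 br ω t) = AddMonoidAlgebra.single (Q p) (envMk ε 𝓛 br ω t) := by
    refine tensorGrading_le (𝓛 := 𝓛) (N := fun p => LinearMap.eqLocus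
      (δ.toLinearMap ∘ₗ (envMk ε 𝓛 br ω).toLinearMap)
      (AddMonoidAlgebra.lsingle (Q p) ∘ₗ (envMk ε 𝓛 br ω).toLinearMap)) ?_ ?_ p ht
    · change δ (envMk ε 𝓛 br ω 1) = AddMonoidAlgebra.single (Q 0) (envMk ε 𝓛 br ω 1)
      rw [map_one, map_one, map_zero]
      rfl
    · intro g p a t ha ht
      change δ (envMk ε 𝓛 br ω _) = AddMonoidAlgebra.single _ (envMk ε 𝓛 br ω _)
      replace ht : δ (envMk ε 𝓛 br ω t) = AddMonoidAlgebra.single _ (envMk ε 𝓛 br ω t) := ht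
      rw [map_mul, map_mul, ht, map_add, ← AddMonoidAlgebra.single_mul_single]
      congr 1
      exact hδ g a ha
  change (δ (envMk ε 𝓛 br ω t)).coeff γ = _
  rw [h, AddMonoidAlgebra.coeff_single, Finsupp.single_apply]

end Projections

/-! ### Direct sum decomposition of the symmetric algebra, and homogeneous leading terms -/

section Gradings

variable {K G L : Type*} [Field K] [AddCommGroup G] [AddCommGroup L] [Module K L] [DecidableEq G]
  {ε : G → G → Kˣ} {𝓛 : G → Submodule K L} {br : L →ₗ[K] L →ₗ[K] L} {ω : L →ₗ[K] L →ₗ[K] K}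

omit [AddCommGroup G] [DecidableEq G] in
theorem envMk_surjective (ε : G → G → Kˣ) (𝓛 : G → Submodule K L) (br : L →ₗ[K] L →ₗ[K] L)
    (ω : L →ₗ[K] L →ₗ[K] K) : Function.Surjective (envMk ε 𝓛 br ω) :=
  RingQuot.mkAlgHom_surjective K _

theorem isInternal_symGrading (h𝓛 : DirectSum.IsInternal 𝓛) :
    DirectSum.IsInternal (symGrading ε 𝓛) := by
  obtain ⟨X, b, d, hb⟩ := exists_isHomogeneousBasis h𝓛
  obtain ⟨π, hπ⟩ := exists_projections (ε := ε) (br := 0) (ω := 0) h𝓛 (AddMonoidHom.id (ℤ × G))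
    (fun _ _ _ _ _ _ => Or.inl rfl) (fun _ _ _ _ _ _ => Or.inl rfl)
  refine DirectSum.isInternal_submodule_of_iSupIndep_of_iSup_eq_top
    (iSupIndep_of_projections _ π ?_ ?_) ?_
  · rintro p _ ⟨t, ht, rfl⟩
    exact (hπ p p t ht).trans (if_pos rfl)
  · rintro p q hpq _ ⟨t, ht, rfl⟩
    exact (hπ p q t ht).trans (if_neg hpq.symm)
  · unfold symGrading
    have hs : LinearMap.range (envMk ε 𝓛 0 0).toLinearMap = ⊤ :=
      LinearMap.range_eq_top.2 (envMk_surjective ε 𝓛 0 0)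
    rw [← Submodule.map_iSup, eq_top_iff, ← hs, LinearMap.range_eq_map, ← iSup_range_ι_pow]
    refine Submodule.map_mono (iSup_le fun n => (range_ι_pow_le_iSup_tensorGrading hb n).trans ?_)
    exact iSup_le fun g => le_iSup (tensorGrading 𝓛) _

instance : SetLike.GradedMonoid (symGrading ε 𝓛) where
  one_mem := ⟨1, one_mem_tensorGrading, map_one (envMk ε 𝓛 0 0)⟩
  mul_mem := by
    rintro p q _ _ ⟨s, hs, rfl⟩ ⟨t, ht, rfl⟩
    exact ⟨s * t, SetLike.mul_mem_graded hs ht, map_mul (envMk ε 𝓛 0 0) s t⟩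

/-- In the symmetric algebra, a homogeneous element of lower order is zero. -/
theorem envMk_sym_eq_zero (h𝓛 : DirectSum.IsInternal 𝓛) {n : ℕ} {t : TensorAlgebra K L}
    (ht : t ∈ LinearMap.range (TensorAlgebra.ι K (M := L)) ^ n)
    (h : envMk ε 𝓛 0 0 t ∈ envFiltration ε 𝓛 0 0 (n - 1)) : envMk ε 𝓛 0 0 t = 0 := by
  obtain ⟨X, b, d, hb⟩ := exists_isHomogeneousBasis h𝓛
  obtain ⟨π, hπ⟩ := exists_projections (ε := ε) (br := 0) (ω := 0) h𝓛 (AddMonoidHom.fst ℤ G)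
    (fun _ _ _ _ _ _ => Or.inl rfl) (fun _ _ _ _ _ _ => Or.inl rfl)
  have h1 : LinearMap.range (TensorAlgebra.ι K (M := L)) ^ n ≤ LinearMap.eqLocus
      (π n ∘ₗ (envMk ε 𝓛 0 0).toLinearMap) (envMk ε 𝓛 0 0).toLinearMap :=
    (range_ι_pow_le_iSup_tensorGrading hb n).trans
      (iSup_le fun g t ht => (hπ n _ t ht).trans (if_pos rfl))
  have h2 : envFiltration ε 𝓛 0 0 (n - 1) ≤ LinearMap.ker (π n) := by
    refine Submodule.map_le_iff_le_comap.2 (iSup₂_le fun m hm =>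
      (range_ι_pow_le_iSup_tensorGrading hb m).trans (iSup_le fun g t ht => ?_))
    refine (hπ n _ t ht).trans (if_neg ?_)
    simp only [AddMonoidHom.coe_fst]
    omega
  have h3 : π n (envMk ε 𝓛 0 0 t) = envMk ε 𝓛 0 0 t := h1 ht
  rw [← h3]
  exact h2 h

omit [DecidableEq G] in
theorem tensorGrading_le_tensorFiltration (n : ℤ) (g : G) :
    tensorGrading 𝓛 (n, g) ≤ tensorFiltration K L n := by
  refine tensorGrading_le (𝓛 := 𝓛) (N := fun p => tensorFiltration K L p.1) ?_ ?_ (n, g)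
  · exact pow_le_tensorFiltration (m := 0) le_rfl (by simp)
  · intro g p a t _ ht
    refine tensorFiltration_mul_le 1 p.1 (Submodule.mul_mem_mul ?_ ht)
    exact pow_le_tensorFiltration (m := 1) le_rfl (by simp)

/-- An element of `U_{n,ω}(L)` of degree `g` is, up to elements of lower order, the image of a tensor
of degree `(n, g)`. -/
theorem exists_tensorGrading_sub_mem (hL : IsColorLieAlgebra ε 𝓛 br)
    (hω : IsScalarTwoCocycle ε 𝓛 br ω) {n : ℤ} {g : G} {x : GenEnv ε 𝓛 br ω}
    (hx : x ∈ envFiltration ε 𝓛 br ω n) (hg : x ∈ envGrading ε 𝓛 br ω g) :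
    ∃ t ∈ tensorGrading 𝓛 (n, g),
      x - envMk ε 𝓛 br ω t ∈ envFiltration ε 𝓛 br ω (n - 1) := by
  obtain ⟨X, b, d, hb⟩ := exists_isHomogeneousBasis hL.isInternal
  obtain ⟨π, hπ⟩ := exists_projections (ε := ε) (br := br) (ω := ω) hL.isInternal
    (AddMonoidHom.snd ℤ G) (fun _ _ _ _ ha hc => Or.inr ⟨hL.bracket_mem ha hc, rfl⟩)
    (fun g h a c ha hc => by
      by_cases h0 : g + h = 0
      · exact Or.inr h0
      · exact Or.inl (hω.degree_zero ha hc h0))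
  have h1 : envGrading ε 𝓛 br ω g ≤ LinearMap.eqLocus (π g) LinearMap.id :=
    Submodule.map_le_iff_le_comap.2 (iSup_le fun m t ht => (hπ g _ t ht).trans (if_pos rfl))
  -- The projection to degree `g` keeps, among tensors of order at most n, those of degree `(n, g)`
  -- and terms of lower order. Applied to `x`, which it fixes, this gives the claim.
  have h2 : envFiltration ε 𝓛 br ω n ≤ ((tensorGrading 𝓛 (n, g)).map
      (envMk ε 𝓛 br ω).toLinearMap ⊔ envFiltration ε 𝓛 br ω (n - 1)).comap (π g) := by
    refine Submodule.map_le_iff_le_comap.2 (iSup₂_le fun m hm =>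
      (range_ι_pow_le_iSup_tensorGrading hb m).trans (iSup_le fun h t ht => ?_))
    rw [Submodule.mem_comap, Submodule.mem_comap, AlgHom.toLinearMap_apply, hπ g _ t ht]
    split_ifs with hgh
    · replace hgh : h = g := hgh
      subst hgh
      rcases hm.eq_or_lt with heq | hlt
      · rw [heq] at ht
        exact Submodule.mem_sup_left (Submodule.mem_map_of_mem ht)
      · have hmt : envMk ε 𝓛 br ω t ∈ envFiltration ε 𝓛 br ω m :=
          ⟨t, tensorGrading_le_tensorFiltration _ _ ht, rfl⟩
        have hle : (m : ℤ) ≤ n - 1 := by omega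
        exact Submodule.mem_sup_right (envFiltration_mono ε 𝓛 br ω hle hmt)
    · exact zero_mem _
  have h3 : π g x = x := h1 hg
  have h4 := h2 hx
  rw [Submodule.mem_comap, h3, Submodule.mem_sup] at h4
  obtain ⟨_, ⟨t, ht, rfl⟩, y, hy, rfl⟩ := h4
  refine ⟨t, ht, ?_⟩
  rwa [AlgHom.toLinearMap_apply, add_sub_cancel_left]

end Gradings

end ColorLie

end

noncomputable section

/-! ### The canonical homomorphism -/

namespace ColorLie

section

variable {K G L : Type*} [Field K] [AddCommGroup G] [AddCommGroup L] [Module K L]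
  (ε : G → G → Kˣ) (𝓛 : G → Submodule K L) (br : L →ₗ[K] L →ₗ[K] L) (ω : L →ₗ[K] L →ₗ[K] K)

/-- The class in `G_ω(L)` of an element of `U_{n,ω}(L)`. -/
def grClass (n : ℤ) : envFiltration ε 𝓛 br ω n →ₗ[K] GrEnv ε 𝓛 br ω :=
  DirectSum.lof K ℤ (FilteredAlg.Gr (envFiltration ε 𝓛 br ω)) n ∘ₗ
    FilteredAlg.symb (envFiltration ε 𝓛 br ω) n

omit [AddCommGroup G] in
theorem grClass_mul {i j n : ℤ} (h : i + j = n) (x : envFiltration ε 𝓛 br ω i)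
    (y : envFiltration ε 𝓛 br ω j) (hxy : (x : GenEnv ε 𝓛 br ω) * y ∈ envFiltration ε 𝓛 br ω n) :
    grClass ε 𝓛 br ω i x * grClass ε 𝓛 br ω j y = grClass ε 𝓛 br ω n ⟨x * y, hxy⟩ := by
  subst h
  exact DirectSum.of_mul_of _ _

omit [AddCommGroup G] in
theorem grClass_eq {n : ℤ} {x y : envFiltration ε 𝓛 br ω n}
    (h : (x : GenEnv ε 𝓛 br ω) - y ∈ envFiltration ε 𝓛 br ω (n - 1)) :
    grClass ε 𝓛 br ω n x = grClass ε 𝓛 br ω n y :=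
  congrArg (DirectSum.lof K ℤ (FilteredAlg.Gr (envFiltration ε 𝓛 br ω)) n)
    (FilteredAlg.symb_eq_symb_iff.2 h)

/-- The tensors of order `n` on which the canonical homomorphism is given by the class of the image
in the enveloping algebra. -/
def classSubmodule (n : ℤ) : Submodule K (TensorAlgebra K L) where
  carrier := {t | ∃ h : envMk ε 𝓛 br ω t ∈ envFiltration ε 𝓛 br ω n,
    canonicalHom ε 𝓛 br ω (envMk ε 𝓛 0 0 t) = grClass ε 𝓛 br ω n ⟨_, h⟩}
  zero_mem' := by
    refine ⟨by rw [map_zero]; exact zero_mem _, ?_⟩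
    simp only [map_zero]
    exact (map_zero (grClass ε 𝓛 br ω n)).symm
  add_mem' := by
    rintro s t ⟨hs, hs'⟩ ⟨ht, ht'⟩
    refine ⟨by rw [map_add]; exact add_mem hs ht, ?_⟩
    rw [map_add, map_add, hs', ht', ← map_add]
    congr 1
    ext
    simp
  smul_mem' := by
    rintro r t ⟨ht, ht'⟩
    refine ⟨by rw [map_smul]; exact Submodule.smul_mem _ _ ht, ?_⟩
    rw [map_smul, map_smul, ht', ← map_smul]
    congr 1
    ext
    simp

/-- Multiplicativity of classes in the associated graded algebra propagates the formula from letters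
to all homogeneous tensors. -/
theorem tensorGrading_le_classSubmodule (p : ℤ × G) :
    tensorGrading 𝓛 p ≤ classSubmodule ε 𝓛 br ω p.1 := by
  refine tensorGrading_le (𝓛 := 𝓛) (N := fun p => classSubmodule ε 𝓛 br ω p.1) ?_ ?_ p
  · refine ⟨by rw [map_one]; exact FilteredAlg.one_mem _, ?_⟩
    rw [map_one, map_one]
    refine (?_ : (1 : GrEnv ε 𝓛 br ω) =
      grClass ε 𝓛 br ω 0 ⟨1, FilteredAlg.one_mem (envFiltration ε 𝓛 br ω)⟩).trans ?_
    · rfl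
    · congr 1
      ext
      exact (map_one (envMk ε 𝓛 br ω)).symm
  · rintro g p a t _ ⟨ht, ht'⟩
    have hmem : envι ε 𝓛 br ω a * envMk ε 𝓛 br ω t ∈ envFiltration ε 𝓛 br ω (1 + p.1) :=
      FilteredAlg.mul_mem _ (envι_mem ε 𝓛 br ω a) ht
    have hmul : envMk ε 𝓛 br ω (TensorAlgebra.ι K a * t) =
      envι ε 𝓛 br ω a * envMk ε 𝓛 br ω t := map_mul _ _ _
    refine ⟨by rw [hmul]; exact hmem, ?_⟩
    have h1 := grClass_mul ε 𝓛 br ω (i := 1) (j := p.1) rfl ⟨_, envι_mem ε 𝓛 br ω a⟩ ⟨_, ht⟩ hmem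
    rw [map_mul, map_mul, ht']
    refine Eq.trans ?_ (h1.trans ?_)
    · congr 1
      exact canonicalHom_ι ε 𝓛 br ω a
    · congr 1
      ext
      exact hmul.symm

variable [DecidableEq G] {ε 𝓛 br ω}

theorem range_ι_pow_le_classSubmodule (h𝓛 : DirectSum.IsInternal 𝓛) (n : ℕ) :
    LinearMap.range (TensorAlgebra.ι K (M := L)) ^ n ≤ classSubmodule ε 𝓛 br ω n := by
  obtain ⟨X, b, d, hb⟩ := exists_isHomogeneousBasis h𝓛
  exact (range_ι_pow_le_iSup_tensorGrading hb n).trans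
    (iSup_le fun g => tensorGrading_le_classSubmodule ε 𝓛 br ω (n, g))

/-- The inclusion from right to left is the delicate one: a representative of order n and degree `g`
may a priori have no lift with both properties, and `exists_tensorGrading_sub_mem` provides one up
to lower order. -/
theorem map_symGrading_canonicalHom (hL : IsColorLieAlgebra ε 𝓛 br)
    (hω : IsScalarTwoCocycle ε 𝓛 br ω) (p : ℤ × G) :
    (symGrading ε 𝓛 p).map (canonicalHom ε 𝓛 br ω).toLinearMap = grGrading ε 𝓛 br ω p := by
  obtain ⟨n, g⟩ := p
  refine le_antisymm ?_ ?_
  · rintro _ ⟨_, ⟨t, ht, rfl⟩, rfl⟩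
    obtain ⟨h, h'⟩ := tensorGrading_le_classSubmodule ε 𝓛 br ω _ ht
    refine ⟨_, ⟨⟨_, h⟩, ?_, rfl⟩, h'.symm⟩
    exact ⟨t, Submodule.mem_iSup_of_mem n ht, rfl⟩
  · rintro _ ⟨_, ⟨⟨x, hx⟩, hg, rfl⟩, rfl⟩
    obtain ⟨t, ht, hxt⟩ := exists_tensorGrading_sub_mem hL hω hx hg
    obtain ⟨h, h'⟩ := tensorGrading_le_classSubmodule ε 𝓛 br ω _ ht
    refine ⟨_, ⟨t, ht, rfl⟩, ?_⟩
    exact h'.trans (grClass_eq ε 𝓛 br ω (x := ⟨x, hx⟩) (y := ⟨_, h⟩) hxt).symm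

theorem canonicalHom_surjective (h𝓛 : DirectSum.IsInternal 𝓛) :
    Function.Surjective (canonicalHom ε 𝓛 br ω) := by
  rw [← AlgHom.range_eq_top, eq_top_iff]
  rintro y -
  induction y using DirectSum.induction_on with
  | zero => exact zero_mem _
  | add y z hy hz => exact add_mem hy hz
  | of n y =>
    obtain ⟨⟨x, hx⟩, rfl⟩ := FilteredAlg.symb_surjective n y
    obtain ⟨t, ht, rfl⟩ := id hx
    have hle : tensorFiltration K L n ≤ classSubmodule ε 𝓛 br ω n ⊔ tensorFiltration K L (n - 1) := by
      refine iSup₂_le fun m hm => ?_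
      rcases hm.eq_or_lt with rfl | hlt
      · exact (range_ι_pow_le_classSubmodule h𝓛 m).trans le_sup_left
      · exact (pow_le_tensorFiltration (by omega)).trans le_sup_right
    obtain ⟨s, ⟨h, h'⟩, r, hr, rfl⟩ := Submodule.mem_sup.1 (hle ht)
    refine ⟨envMk ε 𝓛 0 0 s, h'.trans (grClass_eq ε 𝓛 br ω (x := ⟨_, h⟩) (y := ⟨_, hx⟩) ?_)⟩
    change envMk ε 𝓛 br ω s - envMk ε 𝓛 br ω (s + r) ∈ _
    rw [map_add, sub_add_cancel_left]
    exact neg_mem ⟨r, hr, rfl⟩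

theorem canonicalHom_injective [CharZero K] (hε : IsAntisymmBicharacter ε)
    (hL : IsColorLieAlgebra ε 𝓛 br) (hω : IsScalarTwoCocycle ε 𝓛 br ω) :
    Function.Injective (canonicalHom ε 𝓛 br ω) := by
  classical
  rw [injective_iff_map_eq_zero]
  intro x hx
  obtain ⟨t, rfl⟩ := envMk_surjective ε 𝓛 0 0 x
  -- The components of `t` of different orders have classes in different summands of the associated
  -- graded algebra, so each class vanishes separately.
  set c : ℕ → TensorAlgebra K L := fun n => DirectSum.decompose
    (fun n : ℕ => LinearMap.range (TensorAlgebra.ι K (M := L)) ^ n) t n with hc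
  have hcm : ∀ n, c n ∈ LinearMap.range (TensorAlgebra.ι K (M := L)) ^ n := fun n => by
    rw [hc]
    exact SetLike.coe_mem _
  obtain ⟨S, hS⟩ : ∃ S : Finset ℕ, ∑ n ∈ S, c n = t := ⟨_, DirectSum.sum_support_decompose
    (fun n : ℕ => LinearMap.range (TensorAlgebra.ι K (M := L)) ^ n) t⟩
  choose h h' using fun n =>
    range_ι_pow_le_classSubmodule (ε := ε) (br := br) (ω := ω) hL.isInternal n (hcm n)
  rw [← hS, map_sum]
  refine Finset.sum_eq_zero fun n hn => ?_
  refine envMk_sym_eq_zero hL.isInternal (hcm n)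
    (envMk_sym_mem_of_envMk_mem hε hL hω (hcm n) ?_)
  rw [← hS, map_sum, map_sum, Finset.sum_congr rfl fun n _ => h' n] at hx
  have hx' := congrArg (DirectSum.component K ℤ (FilteredAlg.Gr (envFiltration ε 𝓛 br ω)) n) hx
  rw [map_sum, map_zero, Finset.sum_eq_single_of_mem n hn] at hx'
  · have h0 : FilteredAlg.symb (envFiltration ε 𝓛 br ω) n ⟨_, h n⟩ =
        FilteredAlg.symb (envFiltration ε 𝓛 br ω) n 0 := by
      rw [map_zero, ← hx']
      exact (DirectSum.component.lof_self K _ _).symm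
    have := FilteredAlg.symb_eq_symb_iff.1 h0
    simpa using this
  · intro m _ hm
    exact DirectSum.of_eq_of_ne _ _ _ (by exact_mod_cast hm.symm)

omit [DecidableEq G] in
theorem algHom_eq_canonicalHom_iff (ψ : SymAlg ε 𝓛 →ₐ[K] GrEnv ε 𝓛 br ω) :
    (∀ a : L, ψ (envι ε 𝓛 0 0 a) = grι ε 𝓛 br ω a) ↔ ψ = canonicalHom ε 𝓛 br ω := by
  constructor
  · intro h
    refine RingQuot.ringQuot_ext' K _ _ (TensorAlgebra.hom_ext (LinearMap.ext fun a => ?_))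
    exact (h a).trans (canonicalHom_ι ε 𝓛 br ω a).symm
  · rintro rfl a
    exact canonicalHom_ι ε 𝓛 br ω a

end

/-- A grading is transported along an isomorphism of algebras. -/
theorem nonempty_gradedAlgebra_of_map {K A B Γ : Type*} [Field K] [Ring A] [Algebra K A] [Ring B]
    [Algebra K B] [AddCommMonoid Γ] [DecidableEq Γ] {𝒜 : Γ → Submodule K A}
    [SetLike.GradedMonoid 𝒜] (h𝒜 : DirectSum.IsInternal 𝒜) {ℬ : Γ → Submodule K B} (φ : A →ₐ[K] B)
    (hφ : Function.Bijective φ) (hmap : ∀ p, (𝒜 p).map φ.toLinearMap = ℬ p) :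
    Nonempty (GradedAlgebra ℬ) := by
  have hgr : SetLike.GradedMonoid ℬ :=
    { one_mem := by
        rw [← hmap]
        exact ⟨1, SetLike.one_mem_graded 𝒜, map_one φ⟩
      mul_mem := by
        intro p q x y hx hy
        rw [← hmap] at hx hy ⊢
        obtain ⟨a, ha, rfl⟩ := hx
        obtain ⟨b, hb, rfl⟩ := hy
        exact ⟨a * b, SetLike.mul_mem_graded ha hb, map_mul φ a b⟩ }
  let e : A ≃ₗ[K] B := LinearEquiv.ofBijective φ.toLinearMap hφ
  have he : ℬ = Submodule.orderIsoMapComap e ∘ 𝒜 := funext fun p => (hmap p).symm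
  have hint : DirectSum.IsInternal ℬ := by
    refine DirectSum.isInternal_submodule_of_iSupIndep_of_iSup_eq_top ?_ ?_
    · rw [he]
      exact h𝒜.submodule_iSupIndep.map_orderIso _
    · rw [he, Function.comp_def, ← OrderIso.map_iSup, h𝒜.submodule_iSup_eq_top, OrderIso.map_top]
  exact ⟨{ hgr, hint.chooseDecomposition with }⟩

end ColorLie

end

theorem proposition2p3 {K G L : Type*} [Field K] [CharZero K] [AddCommGroup G] [DecidableEq G]
    [AddCommGroup L] [Module K L]
    (ε : G → G → Kˣ) (hε : ColorLie.IsAntisymmBicharacter ε)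
    (𝓛 : G → Submodule K L) (br : L →ₗ[K] L →ₗ[K] L)
    (hL : ColorLie.IsColorLieAlgebra ε 𝓛 br)
    (ω : L →ₗ[K] L →ₗ[K] K) (hω : ColorLie.IsScalarTwoCocycle ε 𝓛 br ω) :
    Nonempty (GradedAlgebra (ColorLie.symGrading ε 𝓛)) ∧
    Nonempty (GradedAlgebra (ColorLie.grGrading ε 𝓛 br ω)) ∧
    (∀ ψ : ColorLie.SymAlg ε 𝓛 →ₐ[K] ColorLie.GrEnv ε 𝓛 br ω,
      (∀ a : L, ψ (ColorLie.envι ε 𝓛 0 0 a) = ColorLie.grι ε 𝓛 br ω a) ↔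
        ψ = ColorLie.canonicalHom ε 𝓛 br ω) ∧
    (∀ p : ℤ × G, (ColorLie.symGrading ε 𝓛 p).map (ColorLie.canonicalHom ε 𝓛 br ω).toLinearMap
      = ColorLie.grGrading ε 𝓛 br ω p) ∧
    Function.Bijective (ColorLie.canonicalHom ε 𝓛 br ω) := by
  have hmap := ColorLie.map_symGrading_canonicalHom hL hω
  have hbij : Function.Bijective (ColorLie.canonicalHom ε 𝓛 br ω) :=
    ⟨ColorLie.canonicalHom_injective hε hL hω, ColorLie.canonicalHom_surjective hL.isInternal⟩
  have hint := ColorLie.isInternal_symGrading (ε := ε) hL.isInternal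
  -- That the components of `G_ω(L)` form a direct sum is deduced from the isomorphism, not shown
  -- beforehand.
  exact ⟨⟨{ hint.chooseDecomposition with }⟩,
    ColorLie.nonempty_gradedAlgebra_of_map hint _ hbij hmap,
    ColorLie.algHom_eq_canonicalHom_iff, hmap, hbij⟩
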